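/- Let $V:\mathbb{R}^d\to\mathbb{R}^d$ be monotone, $\langle V(\mathbf z)-V(\mathbf z'),\mathbf z-\mathbf z'\rangle\ge 0$, and $L$-smooth, $\|V(\mathbf z)-V(\mathbf z')\|\le L\|\mathbf z-\mathbf z'\|$ with $L>0$, and suppose $\|V(\mathbf x)\|\le G$ for all $\mathbf x\in\mathbb{R}^d$. Suppose further that $V$ is differentiable with Jacobian $J_V$ and that for some $\Lambda>0$, for all $\mathbf x,\mathbf y\in\mathbb{R}^d$, $$\|V(\mathbf x)-V(\mathbf y)-J_V(\mathbf y)(\mathbf x-\mathbf y)\|\le\Lambda\|\mathbf x-\mathbf y\|^2 .$$ Let $\widetilde V:\mathbb{R}^d\times\Xi\to\mathbb{R}^d$ be a stochastic oracle with $\mathbb{E}_\xi[\widetilde V(\mathbf z,\xi)]=V(\mathbf z)$ and $\mathbb{E}_\xi\|V(\mathbf z)-\widetilde V(\mathbf z,\xi)\|^2\le\sigma^2$ for every $\mathbf z$, where $\sigma\ge0$. For integers $M,K,R\ge1$, $H\ge 0$, $T=KR$, and step sizes $\eta,\gamma>0$, the algorithm LIPPAX starts from $\mathbf z_0^m=\mathbf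 0$ for $m=1,\dots,M$ and, in each round $t=1,\dots,T$, each machine $m$ sets $\mathbf x_{t,0}^m=\mathbf z_{t-1}^m$, $$\mathbf x_{t,\ell}^m=\mathbf x_{t,\ell-1}^m-\gamma\Big(\widetilde V(\mathbf x_{t,\ell-1}^m)+\tfrac1\eta(\mathbf x_{t,\ell-1}^m-\mathbf z_{t-1}^m)\Big)\quad(\ell=1,\dots,H),\qquad \mathbf x_t^m=\mathbf x_{t,H}^m,$$ and then $\mathbf z_t^m=\mathbf z_{t-1}^m-\eta\widetilde V(\mathbf x_t^m)$ if $K\nmid t$, and $\mathbf z_t^m=\frac1M\sum_{m'=1}^M\big(\mathbf z_{t-1}^{m'}-\eta\widetilde V(\mathbf x_t^{m'})\big)$ if $K\mid t$. Every evaluation of $\widetilde V$ uses a fresh independent sample $\xi$. The output is $\mathbf x_o=\frac1{MT}\sum_{m=1}^M\sum_{t=1}^T\mathbf x_t^m$. Let $D>0$, $\mathcal Z_D=\{\mathbf z\in\mathbb{R}^d:\|\mathbf z\|\le D\}$, $$\eta=\min\left\{\frac1L,\frac{D^{2/5}}{K^{3/5}R^{1/5}\sigma^{2/5}L^{2/5}},\frac{D^{2/3}}{K^{2/3}R^{1/3}\sigma^{2/3}L^{1/3}},\frac{D^{1/2}}{K^{1/4}R^{1/4}\sigma^{1/2}L^{1/2}},\frac{D^{1/3}}{\Lambda^{1/3}\sigma^{2/3}R^{1/6}K^{1/6}},\frac{D\sqrt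 M}{K^{1/2}R^{1/2}\sigma}\right\}$$ (with $\eta=1/L$ if $\sigma=0$) and $\gamma=\frac{1}{\eta(L+1/\eta)^2}$. Assume $\eta\le1$, which holds in particular whenever $L\ge1$. Then $$\begin{aligned}\mathbb{E}\Big[\sup_{\mathbf z\in\mathcal Z_D}\langle V(\mathbf z),\mathbf x_o-\mathbf z\rangle\Big]\le{}&240\left[\frac{D^2L}{KR}+\frac{D^{4/3}L^{1/3}\sigma^{2/3}}{K^{1/3}R^{2/3}}+\frac{D\sigma}{\sqrt{MKR}}\right]\\&+240\left[\frac{D^{8/5}\sigma^{2/5}L^{2/5}}{K^{2/5}R^{4/5}}+\frac{D^{3/2}\sigma^{1/2}L^{1/2}}{K^{3/4}R^{3/4}}+\frac{D^{5/3}d^{1/6}\Lambda^{1/3}\sigma^{2/3}}{R^{5/6}K^{5/6}}\right]\\&+\frac{10H^2\Lambda^2G^4+60G^2+120G^2K^2}{4^H}.\end{aligned}$$ -/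

import Mathlib

open MeasureTheory ProbabilityTheory

noncomputable section

namespace FedVI

/-- The Euclidean space `ℝ^d`. -/
abbrev Vec (d : ℕ) : Type := EuclideanSpace ℝ (Fin d)

/-- Monotonicity of an operator. -/
def MonotoneOp {d : ℕ} (V : Vec d → Vec d) : Prop :=
  ∀ z z' : Vec d, 0 ≤ inner ℝ (V z - V z') (z - z')

/-- `L`-smoothness of an operator, i.e. Lipschitz continuity with constant `L`. -/
def SmoothOp {d : ℕ} (L : ℝ) (V : Vec d → Vec d) : Prop :=
  ∀ z z' : Vec d, ‖V z - V z'‖ ≤ L * ‖z - z'‖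

/-- Second-order boundedness with constant `Lam`; the Jacobian of `V` at `y` is `fderiv ℝ V y`. -/
def SecondOrderBounded {d : ℕ} (Lam : ℝ) (V : Vec d → Vec d) : Prop :=
  Differentiable ℝ V ∧
    ∀ x y : Vec d, ‖V x - V y - fderiv ℝ V y (x - y)‖ ≤ Lam * ‖x - y‖ ^ 2

/-- `Vt` is an unbiased stochastic oracle for `V`, for samples with law `P`, whose variance is at
most `σ ^ 2` at every point. -/
structure IsOracle {d : ℕ} {Ξ : Type*} [MeasurableSpace Ξ] (V : Vec d → Vec d)
    (Vt : Vec d → Ξ → Vec d) (P : Measure Ξ) (σ : ℝ) : Prop where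
  measurable : Measurable (Function.uncurry Vt)
  integrable : ∀ z, Integrable (Vt z) P
  unbiased : ∀ z, ∫ s, Vt z s ∂P = V z
  integrable_sq : ∀ z, Integrable (fun s => ‖V z - Vt z s‖ ^ 2) P
  variance_le : ∀ z, ∫ s, ‖V z - Vt z s‖ ^ 2 ∂P ≤ σ ^ 2

/-- The samples `ξ t m ℓ` (round, machine, query) are independent and all have law `P`. -/
structure IsIIDSample {Ω Ξ : Type*} [MeasurableSpace Ω] [MeasurableSpace Ξ] {M : ℕ}
    (ξ : ℕ → Fin M → ℕ → Ω → Ξ) (P : Measure Ξ) (μ : Measure Ω) : Prop where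
  measurable : ∀ t m ℓ, Measurable (ξ t m ℓ)
  law : ∀ t m ℓ, μ.map (ξ t m ℓ) = P
  indep : iIndepFun (fun i : ℕ × Fin M × ℕ => ξ i.1 i.2.1 i.2.2) μ

section Algorithm

variable {d : ℕ} {Ξ : Type*}

/-- Inner loop of LIPPAX on one machine in one round: stochastic steps of size `γ` on
`x ↦ V x + (x - z) / η`, started at `z`. Step `ℓ = 1, 2, …` uses the sample `s ℓ`. -/
def innerLoop (Vt : Vec d → Ξ → Vec d) (η γ : ℝ) (z : Vec d) (s : ℕ → Ξ) : ℕ → Vec d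
  | 0 => z
  | ℓ + 1 =>
      innerLoop Vt η γ z s ℓ
        - γ • (Vt (innerLoop Vt η γ z s ℓ) (s (ℓ + 1))
            + (1 / η) • (innerLoop Vt η γ z s ℓ - z))

/-- The local step `z - η Vt(x)`, where `x` is the result of `H` inner steps from `z`; this last
query uses the fresh sample `s (H + 1)`. -/
def localStep (Vt : Vec d → Ξ → Vec d) (η γ : ℝ) (H : ℕ) (z : Vec d) (s : ℕ → Ξ) : Vec d :=
  z - η • Vt (innerLoop Vt η γ z s H) (s (H + 1))

/-- The LIPPAX iterates `z_t^m` for `M` machines that average their iterates whenever `K ∣ t`,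
run on the samples `s t m ℓ`. -/
def lippaxZ {M : ℕ} (Vt : Vec d → Ξ → Vec d) (η γ : ℝ) (H K : ℕ) (s : ℕ → Fin M → ℕ → Ξ) :
    ℕ → Fin M → Vec d
  | 0 => fun _ => 0
  | t + 1 => fun m =>
      if (t + 1) % K = 0 then
        (1 / (M : ℝ)) • ∑ m' : Fin M,
          localStep Vt η γ H (lippaxZ Vt η γ H K s t m') (s (t + 1) m')
      else
        localStep Vt η γ H (lippaxZ Vt η γ H K s t m) (s (t + 1) m)

/-- The LIPPAX iterates `x_t^m`, for `t ≥ 1`. -/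
def lippaxX {M : ℕ} (Vt : Vec d → Ξ → Vec d) (η γ : ℝ) (H K : ℕ) (s : ℕ → Fin M → ℕ → Ξ)
    (t : ℕ) (m : Fin M) : Vec d :=
  innerLoop Vt η γ (lippaxZ Vt η γ H K s (t - 1) m) (s t m) H

/-- The output of LIPPAX after `T` rounds: the average of all `x_t^m`, `1 ≤ t ≤ T`. -/
def lippaxOutput {M : ℕ} (Vt : Vec d → Ξ → Vec d) (η γ : ℝ) (H K T : ℕ)
    (s : ℕ → Fin M → ℕ → Ξ) : Vec d :=
  (1 / ((M : ℝ) * (T : ℝ))) •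
    ∑ m : Fin M, ∑ t ∈ Finset.Icc 1 T, lippaxX Vt η γ H K s t m

end Algorithm

/-- The restricted gap `sup ⟨V z, x - z⟩` over the ball of radius `D` around the common starting
point `0` of the machines. -/
def gap {d : ℕ} (V : Vec d → Vec d) (D : ℝ) (x : Vec d) : ℝ :=
  ⨆ z : Metric.closedBall (0 : Vec d) D, inner ℝ (V (z : Vec d)) (x - (z : Vec d))

/-- The step size `η`. For `σ = 0` the terms with `σ` in the denominator are infinite, so that the
minimum is `1 / L`. -/
def stepSize (L D σ Lam : ℝ) (M K R : ℕ) : ℝ :=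
  if σ = 0 then 1 / L
  else
    min (1 / L) <|
    min (D ^ (2 / 5 : ℝ) /
      ((K : ℝ) ^ (3 / 5 : ℝ) * (R : ℝ) ^ (1 / 5 : ℝ) * σ ^ (2 / 5 : ℝ) * L ^ (2 / 5 : ℝ))) <|
    min (D ^ (2 / 3 : ℝ) /
      ((K : ℝ) ^ (2 / 3 : ℝ) * (R : ℝ) ^ (1 / 3 : ℝ) * σ ^ (2 / 3 : ℝ) * L ^ (1 / 3 : ℝ))) <|
    min (D ^ (1 / 2 : ℝ) /
      ((K : ℝ) ^ (1 / 4 : ℝ) * (R : ℝ) ^ (1 / 4 : ℝ) * σ ^ (1 / 2 : ℝ) * L ^ (1 / 2 : ℝ))) <|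
    min (D ^ (1 / 3 : ℝ) /
      (Lam ^ (1 / 3 : ℝ) * σ ^ (2 / 3 : ℝ) * (R : ℝ) ^ (1 / 6 : ℝ) * (K : ℝ) ^ (1 / 6 : ℝ)))
      (D * Real.sqrt M / ((K : ℝ) ^ (1 / 2 : ℝ) * (R : ℝ) ^ (1 / 2 : ℝ) * σ))

/-- The inner step size `γ`. -/
def innerStepSize (L η : ℝ) : ℝ := 1 / (η * (L + 1 / η) ^ 2)

end FedVI

end

/-!
The inner loop approximates the resolvent `p = (1 + η V)⁻¹ z` of the current iterate `z`: every
inner step contracts the squared distance to `p` and adds independent noise, so that `x` misses `p`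
by a geometrically small multiple of `‖z - p‖ ≤ η G` and by noise of variance at most `η² σ²`. The
extragradient identity for the squared distance to a comparator then bounds the regret of a round,
and the terms that are linear in the comparator sum to a martingale of order `σ / √(M T)`.

If `η L K` is bounded below, the noise `η σ²` of a single machine is already of the order
`D² / (η K R)` by the choice of `η`, and averaging can be ignored. If `η L K` is small, one follows
the average of the machines instead, whose steps carry noise of variance `σ² / M` only. The
disagreement of the machines vanishes at every averaging and grows by a factor `1 + O(η L)` per
round in between, driven by the noise and by the steps `z - p`, and the latter are paid for by the
negative term `-‖z - p‖²` in the bound of the regret. Both cases give the order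
`D² / (η K R) + D σ / √(M K R)`, in which the candidates for `η` produce the terms of the rate.
-/

noncomputable section

namespace FedVI

/-! ### The resolvent and the inner step -/

section Resolvent

variable {d : ℕ} {V : Vec d → Vec d} {L η a : ℝ}

/-- The ratio `γ / η` of the two step sizes, as a function of `a = η * L`. -/
def innerRatio (a : ℝ) : ℝ := 1 / (1 + a) ^ 2

/-- The factor by which an exact inner step contracts squared distances, for `a = η * L`. -/
def contractionFactor (a : ℝ) : ℝ := (1 - innerRatio a) ^ 2 + innerRatio a ^ 2 * a ^ 2

lemma innerStepSize_eq (ha : 0 ≤ η * L) (hη : 0 < η) :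
    innerStepSize L η = η * innerRatio (η * L) := by
  have hL : L + 1 / η = (1 + η * L) / η := by field_simp; ring
  rw [innerStepSize, innerRatio, hL]
  field_simp

lemma innerRatio_nonneg (a : ℝ) : 0 ≤ innerRatio a := by unfold innerRatio; positivity

lemma innerRatio_pos (ha : 0 ≤ a) : 0 < innerRatio a := by unfold innerRatio; positivity

lemma innerRatio_mul_sq (ha : 0 ≤ a) : innerRatio a * (1 + a) ^ 2 = 1 :=
  div_mul_cancel₀ 1 (by positivity)

lemma innerRatio_le_one (ha : 0 ≤ a) : innerRatio a ≤ 1 :=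
  div_le_one_of_le₀ (by nlinarith) (by positivity)

lemma one_sub_innerRatio_le (ha : 0 ≤ a) : 1 - innerRatio a ≤ 2 * a := by
  have h : 0 < (1 + a) ^ 2 := by positivity
  rw [innerRatio, sub_le_iff_le_add, ← sub_le_iff_le_add', le_div_iff₀ h]
  nlinarith [pow_nonneg ha 3, sq_nonneg a]

lemma contractionFactor_nonneg (a : ℝ) : 0 ≤ contractionFactor a := by
  unfold contractionFactor; positivity

lemma contractionFactor_le_one_sub (ha : 0 ≤ a) : contractionFactor a ≤ 1 - innerRatio a := by
  have h : innerRatio a * a ^ 2 ≤ 1 - innerRatio a := by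
    nlinarith [innerRatio_mul_sq ha, mul_nonneg (innerRatio_nonneg a) ha]
  unfold contractionFactor
  nlinarith [innerRatio_nonneg a]

lemma contractionFactor_lt_one (ha : 0 ≤ a) : contractionFactor a < 1 :=
  (contractionFactor_le_one_sub ha).trans_lt (sub_lt_self 1 (innerRatio_pos ha))

lemma contractionFactor_le (ha : 0 ≤ a) (ha1 : a ≤ 1) : contractionFactor a ≤ 5 / 8 := by
  have hc0 := innerRatio_nonneg a
  have hc1 := innerRatio_le_one ha
  have hc : 1 / 4 ≤ innerRatio a := by
    rw [innerRatio, div_le_div_iff₀ (by norm_num) (by positivity)]; nlinarith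
  have hca := innerRatio_mul_sq ha
  have hca_le : innerRatio a * a ≤ 1 / 4 := by nlinarith [mul_nonneg hc0 (sq_nonneg (1 - a))]
  unfold contractionFactor
  nlinarith

lemma contractionFactor_le_five_mul_sq (ha : 0 ≤ a) : contractionFactor a ≤ 5 * a ^ 2 := by
  have hc : (1 - innerRatio a) ^ 2 ≤ (2 * a) ^ 2 :=
    pow_le_pow_left₀ (by linarith [innerRatio_le_one ha]) (one_sub_innerRatio_le ha) 2
  have hc1 : innerRatio a ^ 2 ≤ 1 := pow_le_one₀ (innerRatio_nonneg a) (innerRatio_le_one ha)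
  unfold contractionFactor
  nlinarith [sq_nonneg a]

lemma SmoothOp.continuous (h : SmoothOp L V) (hL : 0 ≤ L) : Continuous V := by
  have : LipschitzWith L.toNNReal V := LipschitzWith.of_dist_le_mul fun x y => by
    simpa [dist_eq_norm, hL] using h x y
  exact this.continuous

lemma norm_sq_innerStep_le (hmono : MonotoneOp V) (hsmooth : SmoothOp L V) (hη : 0 ≤ η)
    (ha : 0 ≤ η * L) (x p : Vec d) :
    ‖(1 - innerRatio (η * L)) • (x - p) - (η * innerRatio (η * L)) • (V x - V p)‖ ^ 2
      ≤ contractionFactor (η * L) * ‖x - p‖ ^ 2 := by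
  have hc0 := innerRatio_nonneg (η * L)
  have hc1 : 0 ≤ 1 - innerRatio (η * L) := sub_nonneg.2 (innerRatio_le_one ha)
  unfold contractionFactor
  set c := innerRatio (η * L)
  have hcross : 0 ≤ (1 - c) * (η * c * inner ℝ (V x - V p) (x - p)) :=
    mul_nonneg hc1 (mul_nonneg (mul_nonneg hη hc0) (hmono x p))
  have hsq : (η * c) ^ 2 * ‖V x - V p‖ ^ 2 ≤ (η * c) ^ 2 * (L * ‖x - p‖) ^ 2 := by
    gcongr
    exact hsmooth x p
  rw [norm_sub_sq_real, norm_smul, norm_smul, real_inner_smul_left, real_inner_smul_right,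
    real_inner_comm, Real.norm_of_nonneg hc1, Real.norm_of_nonneg (mul_nonneg hη hc0)]
  nlinarith

lemma exists_add_smul_eq (hmono : MonotoneOp V) (hsmooth : SmoothOp L V) (hη : 0 ≤ η)
    (ha : 0 ≤ η * L) (z : Vec d) : ∃ p : Vec d, p + η • V p = z := by
  set c := innerRatio (η * L)
  set q := contractionFactor (η * L)
  -- The exact inner step is a contraction whose fixed point is the resolvent of `z`.
  let f : Vec d → Vec d := fun x => (1 - c) • x - (η * c) • V x + c • z
  have hf : ContractingWith (√q).toNNReal f := by
    refine ⟨?_, LipschitzWith.of_dist_le_mul fun x y => ?_⟩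
    · simpa [← NNReal.coe_lt_coe, Real.sqrt_lt' one_pos] using contractionFactor_lt_one ha
    · have hxy : f x - f y = (1 - c) • (x - y) - (η * c) • (V x - V y) := by
        simp only [f]; module
      rw [dist_eq_norm, dist_eq_norm, hxy]
      refine le_of_sq_le_sq ?_ (by positivity)
      rw [mul_pow]
      simpa [Real.sq_sqrt (contractionFactor_nonneg (η * L)), q] using
        norm_sq_innerStep_le hmono hsmooth hη ha x y
  set p := hf.fixedPoint f
  refine ⟨p, smul_right_injective _ (innerRatio_pos ha).ne' ?_⟩
  have hp : f p - p = 0 := sub_eq_zero.2 hf.fixedPoint_isFixedPt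
  change c • (p + η • V p) = c • z
  rw [← sub_eq_zero, ← neg_eq_zero, ← hp]
  simp only [f]; module

/-- The resolvent `(1 + η V)⁻¹`, that is, the exact proximal step that the inner loop
approximates. Its values are those of `Classical.epsilon`, arbitrary at points outside the range
of `1 + η V`. -/
def resolvent (V : Vec d → Vec d) (η : ℝ) (z : Vec d) : Vec d :=
  Classical.epsilon fun p => p + η • V p = z

lemma resolvent_add_smul (hmono : MonotoneOp V) (hsmooth : SmoothOp L V) (hη : 0 ≤ η)
    (ha : 0 ≤ η * L) (z : Vec d) : resolvent V η z + η • V (resolvent V η z) = z :=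
  Classical.epsilon_spec (exists_add_smul_eq hmono hsmooth hη ha z)

lemma continuous_resolvent (hmono : MonotoneOp V) (hsmooth : SmoothOp L V) (hη : 0 ≤ η)
    (ha : 0 ≤ η * L) : Continuous (resolvent V η) := by
  have : LipschitzWith 1 (resolvent V η) := LipschitzWith.of_dist_le_mul fun z w => by
    have hz := resolvent_add_smul hmono hsmooth hη ha z
    have hw := resolvent_add_smul hmono hsmooth hη ha w
    have hm := hmono (resolvent V η z) (resolvent V η w)
    set p := resolvent V η z
    set p' := resolvent V η w
    have hzw : z - w = (p - p') + η • (V p - V p') := by rw [← hz, ← hw]; module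
    have hinner : ‖p - p'‖ * ‖p - p'‖ ≤ inner ℝ (z - w) (p - p') := by
      rw [hzw, inner_add_left, real_inner_self_eq_norm_mul_norm, real_inner_smul_left]
      exact le_add_of_nonneg_right (mul_nonneg hη hm)
    rw [dist_eq_norm, dist_eq_norm, NNReal.coe_one, one_mul]
    by_contra! h
    nlinarith [norm_nonneg (z - w), real_inner_le_norm (z - w) (p - p')]
  exact this.continuous

lemma inner_progress_le (hsmooth : SmoothOp L V) (hη : 0 ≤ η) {x p z : Vec d}
    (hp : p + η • V p = z) :
    2 * η * inner ℝ (V x) (x - z) + η ^ 2 * ‖V x‖ ^ 2 ≤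
      -‖z - p‖ ^ 2 + 2 * inner ℝ (z - p) (x - p)
        + (2 * (η * L) + (η * L) ^ 2) * ‖x - p‖ ^ 2 := by
  set w := V x - V p with hw
  have hs : ‖w‖ ≤ L * ‖x - p‖ := hsmooth x p
  have hzp : z - p = η • V p := by rw [← hp]; abel
  have hxz : x - z = (x - p) - η • V p := by rw [← hp]; abel
  have hVx : V x = V p + w := by rw [hw]; abel
  have hinner : η * inner ℝ w (x - p) ≤ η * (L * ‖x - p‖ ^ 2) := by
    have := real_inner_le_norm w (x - p)
    refine mul_le_mul_of_nonneg_left ?_ hη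
    nlinarith [norm_nonneg (x - p)]
  have hsq : η ^ 2 * ‖w‖ ^ 2 ≤ η ^ 2 * (L * ‖x - p‖) ^ 2 := by gcongr
  rw [hxz, hVx, hzp, norm_add_sq_real, norm_smul, real_inner_smul_left]
  simp only [inner_sub_right, inner_add_left, real_inner_smul_right, real_inner_self_eq_norm_sq,
    Real.norm_of_nonneg hη, real_inner_comm (V p) w] at *
  nlinarith

end Resolvent

/-! ### Second moments and oracle noise -/

section MeanBounds

variable {Ω : Type*} [MeasurableSpace Ω] {μ : Measure Ω} {f g : Ω → ℝ} {a b r : ℝ}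

/-- `f` has mean at most `a`. Integrability is part of the notion, since the Bochner integral of a
non-integrable function is `0`. -/
structure MeanLe (μ : Measure Ω) (f : Ω → ℝ) (a : ℝ) : Prop where
  integrable : Integrable f μ
  integral_le : ∫ ω, f ω ∂μ ≤ a

lemma MeanLe.add (hf : MeanLe μ f a) (hg : MeanLe μ g b) :
    MeanLe μ (fun ω => f ω + g ω) (a + b) where
  integrable := hf.integrable.add hg.integrable
  integral_le := by
    rw [integral_add hf.integrable hg.integrable]
    exact add_le_add hf.integral_le hg.integral_le

lemma MeanLe.const_mul (hf : MeanLe μ f a) (hr : 0 ≤ r) :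
    MeanLe μ (fun ω => r * f ω) (r * a) where
  integrable := hf.integrable.const_mul r
  integral_le := by
    rw [integral_const_mul]
    exact mul_le_mul_of_nonneg_left hf.integral_le hr

lemma MeanLe.of_integral (hf : Integrable f μ) (r : ℝ) :
    MeanLe μ (fun ω => r * f ω) (r * ∫ ω, f ω ∂μ) :=
  ⟨hf.const_mul r, (integral_const_mul _ _).le⟩

lemma MeanLe.trans_le (hf : MeanLe μ f a) (hab : a ≤ b) : MeanLe μ f b :=
  ⟨hf.integrable, hf.integral_le.trans hab⟩

lemma MeanLe.sum {ι : Type*} (s : Finset ι) {f : ι → Ω → ℝ} {a : ι → ℝ}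
    (h : ∀ i ∈ s, MeanLe μ (f i) (a i)) :
    MeanLe μ (fun ω => ∑ i ∈ s, f i ω) (∑ i ∈ s, a i) where
  integrable := integrable_finsetSum _ fun i hi => (h i hi).integrable
  integral_le := by
    rw [integral_finsetSum _ fun i hi => (h i hi).integrable]
    exact Finset.sum_le_sum fun i hi => (h i hi).integral_le

lemma MeanLe.mono (hg : MeanLe μ g b) (hf : Integrable f μ) (h : ∀ ω, f ω ≤ g ω) (hab : b ≤ a) :
    MeanLe μ f a :=
  ⟨hf, ((integral_mono hf hg.integrable h).trans hg.integral_le).trans hab⟩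

end MeanBounds

section SecondMoments

variable {Ω E : Type*} [MeasurableSpace Ω] {μ : Measure Ω}
  [NormedAddCommGroup E] {X Y : Ω → E}

lemma integrable_norm_sq (hX : MemLp X 2 μ) : Integrable (fun ω => ‖X ω‖ ^ 2) μ :=
  hX.integrable_norm_pow two_ne_zero

lemma integral_norm_le_sqrt [IsProbabilityMeasure μ] (hX : MemLp X 2 μ) {C : ℝ}
    (h : ∫ ω, ‖X ω‖ ^ 2 ∂μ ≤ C) : ∫ ω, ‖X ω‖ ∂μ ≤ √C := by
  have hvar := variance_nonneg (fun ω => ‖X ω‖) μ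
  rw [variance_eq_sub hX.norm] at hvar
  exact Real.le_sqrt_of_sq_le ((sub_nonneg.1 hvar).trans h)

variable [InnerProductSpace ℝ E]

lemma integrable_inner (hX : MemLp X 2 μ) (hY : MemLp Y 2 μ) :
    Integrable (fun ω => inner ℝ (X ω) (Y ω)) μ :=
  (hX.norm.integrable_mul hY.norm).mono (hX.1.inner hY.1)
    (Filter.Eventually.of_forall fun ω => by simpa using abs_real_inner_le_norm (X ω) (Y ω))

lemma integral_norm_sub_smul_sq (hX : MemLp X 2 μ) (hY : MemLp Y 2 μ)
    (h : ∫ ω, inner ℝ (X ω) (Y ω) ∂μ = 0) (g : ℝ) :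
    ∫ ω, ‖X ω - g • Y ω‖ ^ 2 ∂μ = ∫ ω, ‖X ω‖ ^ 2 ∂μ + g ^ 2 * ∫ ω, ‖Y ω‖ ^ 2 ∂μ := by
  have hexpand : ∀ ω, ‖X ω - g • Y ω‖ ^ 2
      = ‖X ω‖ ^ 2 - 2 * g * inner ℝ (X ω) (Y ω) + g ^ 2 * ‖Y ω‖ ^ 2 := fun ω => by
    rw [norm_sub_sq_real, real_inner_smul_right, norm_smul, mul_pow, Real.norm_eq_abs, sq_abs]
    ring
  have hXY := (integrable_inner hX hY).const_mul (2 * g)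
  have hsub : Integrable (fun ω => ‖X ω‖ ^ 2 - 2 * g * inner ℝ (X ω) (Y ω)) μ :=
    (integrable_norm_sq hX).sub hXY
  simp_rw [hexpand]
  rw [integral_add hsub ((integrable_norm_sq hY).const_mul _),
    integral_sub (integrable_norm_sq hX) hXY, integral_const_mul, integral_const_mul, h,
    mul_zero, sub_zero]

lemma integral_norm_sum_sq {ι : Type*} (s : Finset ι) {X : ι → Ω → E}
    (hX : ∀ i ∈ s, MemLp (X i) 2 μ)
    (h : ∀ i ∈ s, ∀ j ∈ s, i ≠ j → ∫ ω, inner ℝ (X i ω) (X j ω) ∂μ = 0) :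
    ∫ ω, ‖∑ i ∈ s, X i ω‖ ^ 2 ∂μ = ∑ i ∈ s, ∫ ω, ‖X i ω‖ ^ 2 ∂μ := by
  simp_rw [← real_inner_self_eq_norm_sq, sum_inner, inner_sum]
  rw [integral_finsetSum _ fun i hi => integrable_finsetSum _ fun j hj =>
    integrable_inner (hX i hi) (hX j hj)]
  refine Finset.sum_congr rfl fun i hi => ?_
  rw [integral_finsetSum _ fun j hj => integrable_inner (hX i hi) (hX j hj),
    Finset.sum_eq_single_of_mem i hi fun j hj hij => h i hi j hj hij.symm]

end SecondMoments

section OracleQuery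

variable {d : ℕ} {Ω Ξ : Type*} [MeasurableSpace Ω] [MeasurableSpace Ξ]
  {μ : Measure Ω} {P : Measure Ξ} {V : Vec d → Vec d} {Vt : Vec d → Ξ → Vec d} {σ : ℝ}
  {X Y : Ω → Vec d} {s : Ω → Ξ}

/-- The error of the oracle when it is queried at the random point `X` with the sample `s`. -/
def queryNoise (V : Vec d → Vec d) (Vt : Vec d → Ξ → Vec d) (X : Ω → Vec d) (s : Ω → Ξ)
    (ω : Ω) : Vec d :=
  Vt (X ω) (s ω) - V (X ω)

lemma IsOracle.measurable_uncurry_sub [SFinite P] (ho : IsOracle V Vt P σ) :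
    Measurable fun y : Vec d × Ξ => Vt y.1 y.2 - V y.1 := by
  have hV : Measurable V := by
    have := ho.measurable.stronglyMeasurable.integral_prod_right (ν := P)
    exact (funext ho.unbiased : (fun z => ∫ s, Vt z s ∂P) = V) ▸ this.measurable
  exact ho.measurable.sub (hV.comp measurable_fst)

variable [IsProbabilityMeasure μ]

lemma meanLe_queryNoise_sq (ho : IsOracle V Vt P σ) (hX : Measurable X) (hs : Measurable s)
    (hlaw : μ.map s = P) (hXs : IndepFun X s μ) :
    MeanLe μ (fun ω => ‖queryNoise V Vt X s ω‖ ^ 2) (σ ^ 2) := by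
  have : IsProbabilityMeasure P := hlaw ▸ Measure.isProbabilityMeasure_map hs.aemeasurable
  let g : Vec d × Ξ → ℝ := fun y => ‖Vt y.1 y.2 - V y.1‖ ^ 2
  have hg : Measurable g := ho.measurable_uncurry_sub.norm.pow_const 2
  have hmap : μ.map (fun ω => (X ω, s ω)) = (μ.map X).prod P := by
    rw [(indepFun_iff_map_prod_eq_prod_map_map hX.aemeasurable hs.aemeasurable).1 hXs, hlaw]
  have : IsProbabilityMeasure (μ.map X) := Measure.isProbabilityMeasure_map hX.aemeasurable
  have hslice : ∀ x, ∫ t, g (x, t) ∂P ≤ σ ^ 2 := fun x => by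
    simpa only [g, norm_sub_rev (Vt x _)] using ho.variance_le x
  have hint : Integrable g ((μ.map X).prod P) := by
    refine (integrable_prod_iff hg.aestronglyMeasurable).2
      ⟨.of_forall fun x => by simpa only [g, norm_sub_rev (Vt x _)] using ho.integrable_sq x,
        (integrable_const (σ ^ 2)).mono'
          hg.norm.stronglyMeasurable.integral_prod_right.aestronglyMeasurable
          (.of_forall fun x => ?_)⟩
    have hnonneg : 0 ≤ ∫ t, g (x, t) ∂P := integral_nonneg fun t => sq_nonneg _
    simpa [g, abs_of_nonneg hnonneg] using hslice x
  have hpair := (hX.prodMk hs).aemeasurable (μ := μ)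
  rw [← hmap] at hint
  refine ⟨(integrable_map_measure hg.aestronglyMeasurable hpair).1 hint, ?_⟩
  calc ∫ ω, ‖queryNoise V Vt X s ω‖ ^ 2 ∂μ = ∫ y, g y ∂(μ.map X).prod P := by
        rw [← hmap, integral_map hpair hg.aestronglyMeasurable]; rfl
    _ = ∫ x, ∫ t, g (x, t) ∂P ∂μ.map X := integral_prod _ (hmap ▸ hint)
    _ ≤ ∫ _, σ ^ 2 ∂μ.map X :=
        integral_mono (hmap ▸ hint).integral_prod_left (integrable_const _) hslice
    _ = σ ^ 2 := by simp

lemma memLp_queryNoise (ho : IsOracle V Vt P σ) (hX : Measurable X) (hs : Measurable s)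
    (hlaw : μ.map s = P) (hXs : IndepFun X s μ) : MemLp (queryNoise V Vt X s) 2 μ := by
  have : IsProbabilityMeasure P := hlaw ▸ Measure.isProbabilityMeasure_map hs.aemeasurable
  have hm : Measurable (queryNoise V Vt X s) := ho.measurable_uncurry_sub.comp (hX.prodMk hs)
  exact (memLp_two_iff_integrable_sq_norm hm.aestronglyMeasurable).2
    (meanLe_queryNoise_sq ho hX hs hlaw hXs).integrable

lemma integral_inner_queryNoise (ho : IsOracle V Vt P σ) (hX : Measurable X) (hY : Measurable Y)
    (hs : Measurable s) (hlaw : μ.map s = P) (hXYs : IndepFun (fun ω => (X ω, Y ω)) s μ)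
    (hY2 : MemLp Y 2 μ) : ∫ ω, inner ℝ (Y ω) (queryNoise V Vt X s ω) ∂μ = 0 := by
  have : IsProbabilityMeasure P := hlaw ▸ Measure.isProbabilityMeasure_map hs.aemeasurable
  let g : (Vec d × Vec d) × Ξ → ℝ := fun y => inner ℝ y.1.2 (Vt y.1.1 y.2 - V y.1.1)
  have hg : Measurable g := by
    refine Measurable.inner (by fun_prop) (ho.measurable_uncurry_sub.comp (?_ : Measurable
      fun y : (Vec d × Vec d) × Ξ => (y.1.1, y.2)))
    fun_prop
  have hmap : μ.map (fun ω => ((X ω, Y ω), s ω)) = (μ.map fun ω => (X ω, Y ω)).prod P := by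
    rw [(indepFun_iff_map_prod_eq_prod_map_map (hX.prodMk hY).aemeasurable hs.aemeasurable).1 hXYs,
      hlaw]
  have hpair := ((hX.prodMk hY).prodMk hs).aemeasurable (μ := μ)
  have hint : Integrable g (μ.map fun ω => ((X ω, Y ω), s ω)) :=
    (integrable_map_measure hg.aestronglyMeasurable hpair).2
      (integrable_inner hY2
        (memLp_queryNoise ho hX hs hlaw (hXYs.comp measurable_fst measurable_id)))
  have hslice : ∀ y : Vec d × Vec d, ∫ t, g (y, t) ∂P = 0 := fun y => by
    have hsub : Integrable (fun t => Vt y.1 t - V y.1) P :=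
      (ho.integrable y.1).sub (integrable_const _)
    simp only [g]
    rw [integral_inner hsub, integral_sub (ho.integrable y.1) (integrable_const _), ho.unbiased]
    simp
  calc ∫ ω, inner ℝ (Y ω) (queryNoise V Vt X s ω) ∂μ
      = ∫ y, g y ∂(μ.map fun ω => (X ω, Y ω)).prod P := by
        rw [← hmap, integral_map hpair hg.aestronglyMeasurable]; rfl
    _ = ∫ y, ∫ t, g (y, t) ∂P ∂(μ.map fun ω => (X ω, Y ω)) := integral_prod _ (hmap ▸ hint)
    _ = 0 := by simp_rw [hslice, integral_zero]

end OracleQuery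

/-! ### Measurability of the iterates -/

section SampleAlgebra

variable {d : ℕ} {Ω Ξ : Type*} [mΩ : MeasurableSpace Ω] [MeasurableSpace Ξ] {M : ℕ}
  {μ : Measure Ω} {P : Measure Ξ} {ξ : ℕ → Fin M → ℕ → Ω → Ξ} {S S' : Set (ℕ × Fin M × ℕ)}

/-- The `σ`-algebra generated by the samples with index in `S`. -/
@[reducible]
def sampleAlgebra (ξ : ℕ → Fin M → ℕ → Ω → Ξ) (S : Set (ℕ × Fin M × ℕ)) : MeasurableSpace Ω :=
  ⨆ j ∈ S, MeasurableSpace.comap (ξ j.1 j.2.1 j.2.2) inferInstance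

omit mΩ in
lemma sampleAlgebra_mono (h : S ⊆ S') : sampleAlgebra ξ S ≤ sampleAlgebra ξ S' :=
  biSup_mono fun _ hj => h hj

omit mΩ in
lemma measurable_sample {t : ℕ} {m : Fin M} {ℓ : ℕ} (hi : (t, m, ℓ) ∈ S) :
    Measurable[sampleAlgebra ξ S] (ξ t m ℓ) :=
  Measurable.of_comap_le
    (le_iSup₂_of_le (f := fun (j : ℕ × Fin M × ℕ) (_ : j ∈ S) =>
      MeasurableSpace.comap (ξ j.1 j.2.1 j.2.2) inferInstance) (t, m, ℓ) hi le_rfl)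

lemma IsIIDSample.isProbabilityMeasure (hξ : IsIIDSample ξ P μ) : IsProbabilityMeasure μ :=
  hξ.indep.isProbabilityMeasure

lemma IsIIDSample.sampleAlgebra_le (hξ : IsIIDSample ξ P μ) (S : Set (ℕ × Fin M × ℕ)) :
    sampleAlgebra ξ S ≤ mΩ :=
  iSup₂_le fun j _ => (hξ.measurable j.1 j.2.1 j.2.2).comap_le

lemma IsIIDSample.indepFun (hξ : IsIIDSample ξ P μ) {t : ℕ} {m : Fin M} {ℓ : ℕ}
    (hi : (t, m, ℓ) ∉ S) {β : Type*} [MeasurableSpace β] {Y : Ω → β}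
    (hY : Measurable[sampleAlgebra ξ S] Y) : IndepFun Y (ξ t m ℓ) μ := by
  have h := indep_iSup_of_disjoint (S := S) (T := {(t, m, ℓ)})
    (m := fun j : ℕ × Fin M × ℕ => MeasurableSpace.comap (ξ j.1 j.2.1 j.2.2) inferInstance)
    (fun j => (hξ.measurable j.1 j.2.1 j.2.2).comap_le) hξ.indep
    (Set.disjoint_singleton_right.2 hi)
  rw [iSup_singleton] at h
  rw [IndepFun_iff_Indep]
  exact indep_of_indep_of_le_left h hY.comap_le

/-- `Y` is a square integrable random vector that depends only on the samples with index in `S`. -/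
structure SampleL2 (ξ : ℕ → Fin M → ℕ → Ω → Ξ) (μ : Measure Ω) (S : Set (ℕ × Fin M × ℕ))
    (Y : Ω → Vec d) : Prop where
  measurable : Measurable[sampleAlgebra ξ S] Y
  memLp : MemLp Y 2 μ

namespace SampleL2

variable {X Y : Ω → Vec d}

lemma mono (hY : SampleL2 ξ μ S Y) (h : S ⊆ S') : SampleL2 ξ μ S' Y :=
  ⟨hY.measurable.mono (sampleAlgebra_mono h) le_rfl, hY.memLp⟩

lemma add (hX : SampleL2 ξ μ S X) (hY : SampleL2 ξ μ S Y) :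
    SampleL2 ξ μ S (fun ω => X ω + Y ω) :=
  ⟨hX.measurable.add hY.measurable, hX.memLp.add hY.memLp⟩

lemma sub (hX : SampleL2 ξ μ S X) (hY : SampleL2 ξ μ S Y) :
    SampleL2 ξ μ S (fun ω => X ω - Y ω) :=
  ⟨hX.measurable.sub hY.measurable, hX.memLp.sub hY.memLp⟩

lemma const_smul (hX : SampleL2 ξ μ S X) (c : ℝ) : SampleL2 ξ μ S (fun ω => c • X ω) :=
  ⟨hX.measurable.const_smul c, hX.memLp.const_smul c⟩

lemma sum {ι : Type*} (s : Finset ι) {X : ι → Ω → Vec d} (hX : ∀ i ∈ s, SampleL2 ξ μ S (X i)) :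
    SampleL2 ξ μ S (fun ω => ∑ i ∈ s, X i ω) :=
  ⟨Finset.measurable_fun_sum _ fun i hi => (hX i hi).measurable,
    memLp_finsetSum _ fun i hi => (hX i hi).memLp⟩

end SampleL2

end SampleAlgebra

section PastIndices

variable {M t ℓ : ℕ}

/-- Indices of the samples used in the first `t` rounds and the first `ℓ` queries of the next. -/
def pastIndices (M t ℓ : ℕ) : Set (ℕ × Fin M × ℕ) :=
  {j | j.1 ≤ t ∨ (j.1 = t + 1 ∧ j.2.2 ≤ ℓ)}

lemma pastIndices_mono {ℓ' : ℕ} (h : ℓ ≤ ℓ') : pastIndices M t ℓ ⊆ pastIndices M t ℓ' :=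
  fun _ hj => hj.imp_right fun hj' => ⟨hj'.1, hj'.2.trans h⟩

lemma notMem_pastIndices {m : Fin M} : (t + 1, m, ℓ + 1) ∉ pastIndices M t ℓ := by
  simp [pastIndices]

lemma setOf_le_subset_pastIndices : {j : ℕ × Fin M × ℕ | j.1 ≤ t} ⊆ pastIndices M t ℓ :=
  fun _ hj => Or.inl hj

lemma pastIndices_subset_setOf_le : pastIndices M t ℓ ⊆ {j : ℕ × Fin M × ℕ | j.1 ≤ t + 1} :=
  fun _ hj => hj.elim Nat.le_succ_of_le fun hj' => hj'.1.le

end PastIndices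

/-- The data of a run of LIPPAX on `M` machines: operator, oracle, samples, smoothness constant,
step size, number of inner steps and averaging period. -/
structure Run (d M : ℕ) (Ω Ξ : Type*) where
  V : Vec d → Vec d
  Vt : Vec d → Ξ → Vec d
  ξ : ℕ → Fin M → ℕ → Ω → Ξ
  L : ℝ
  η : ℝ
  H : ℕ
  K : ℕ

namespace Run

section Iterates

variable {d M : ℕ} {Ω Ξ : Type*} (r : Run d M Ω Ξ) (t : ℕ) (m : Fin M) (ℓ : ℕ) (ω : Ω)

/-- The iterate `z_t^m`. -/
def z : Vec d :=
  lippaxZ r.Vt r.η (innerStepSize r.L r.η) r.H r.K (fun t m ℓ => r.ξ t m ℓ ω) t m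

/-- The inner iterate `x_{t+1,ℓ}^m`. The round is shifted by one, so that `r.x t m` starts at
`r.z t m`. -/
def x : Vec d :=
  innerLoop r.Vt r.η (innerStepSize r.L r.η) (r.z t m ω) (fun ℓ => r.ξ (t + 1) m ℓ ω) ℓ

/-- The error of the oracle at `x_{t+1,ℓ}^m`. -/
def noise : Vec d := queryNoise r.V r.Vt (r.x t m ℓ) (r.ξ (t + 1) m (ℓ + 1)) ω

/-- The resolvent point of `z_t^m`, which the inner loop of round `t + 1` approximates. -/
def p : Vec d := resolvent r.V r.η (r.z t m ω)

/-- The result of the outer step of machine `m` in round `t + 1`, before any averaging. -/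
def zLocal : Vec d := r.z t m ω - r.η • (r.V (r.x t m r.H ω) + r.noise t m r.H ω)

lemma x_succ :
    r.x t m (ℓ + 1) ω = r.x t m ℓ ω - innerStepSize r.L r.η •
      (r.V (r.x t m ℓ ω) + r.noise t m ℓ ω + (1 / r.η) • (r.x t m ℓ ω - r.z t m ω)) := by
  rw [noise, queryNoise, add_sub_cancel]
  rfl

lemma z_succ :
    r.z (t + 1) m ω =
      if (t + 1) % r.K = 0 then (1 / (M : ℝ)) • ∑ m' : Fin M, r.zLocal t m' ω
      else r.zLocal t m ω := by
  simp only [zLocal, noise, queryNoise, add_sub_cancel]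
  rfl

end Iterates

variable {d M : ℕ} {Ω Ξ : Type*} [MeasurableSpace Ω] [MeasurableSpace Ξ]

/-- The assumptions of the analysis: a monotone, `L`-smooth operator bounded by `G`, an oracle of
variance at most `σ ^ 2` queried with independent samples, and a step size `η ≤ 1 / L`. -/
structure IsRegular (r : Run d M Ω Ξ) (μ : Measure Ω) (P : Measure Ξ) (G σ : ℝ) : Prop where
  mono : MonotoneOp r.V
  smooth : SmoothOp r.L r.V
  bound : ∀ x, ‖r.V x‖ ≤ G
  oracle : IsOracle r.V r.Vt P σ
  iid : IsIIDSample r.ξ P μ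
  L_pos : 0 < r.L
  η_pos : 0 < r.η
  ηL_le : r.η * r.L ≤ 1
  M_pos : 0 < M
  K_pos : 0 < r.K

namespace IsRegular

variable {r : Run d M Ω Ξ} {μ : Measure Ω} {P : Measure Ξ} {G σ : ℝ} (h : r.IsRegular μ P G σ)
include h

lemma ηL_nonneg : 0 ≤ r.η * r.L := mul_nonneg h.η_pos.le h.L_pos.le

lemma M_pos_real : (0 : ℝ) < M := Nat.cast_pos.2 h.M_pos

lemma sampleL2_comp {S : Set (ℕ × Fin M × ℕ)} {X : Ω → Vec d}
    (hX : Measurable[sampleAlgebra r.ξ S] X) : SampleL2 r.ξ μ S (fun ω => r.V (X ω)) where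
  measurable := (h.smooth.continuous h.L_pos.le).measurable.comp hX
  memLp := by
    have := h.iid.isProbabilityMeasure
    exact MemLp.of_bound ((h.smooth.continuous h.L_pos.le).measurable.comp
      (hX.mono (h.iid.sampleAlgebra_le S) le_rfl)).aestronglyMeasurable G
      (.of_forall fun _ => h.bound _)

lemma sampleL2_noise_of_measurable {S : Set (ℕ × Fin M × ℕ)} {t : ℕ} {m : Fin M} {ℓ : ℕ}
    (hX : Measurable[sampleAlgebra r.ξ (pastIndices M t ℓ)] (r.x t m ℓ))
    (hS : pastIndices M t ℓ ⊆ S) (hi : (t + 1, m, ℓ + 1) ∈ S) :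
    SampleL2 r.ξ μ S (r.noise t m ℓ) where
  measurable := by
    have hXS := hX.mono (sampleAlgebra_mono hS) le_rfl
    exact (h.oracle.measurable.comp (hXS.prodMk (measurable_sample hi))).sub
      (h.sampleL2_comp hXS).measurable
  memLp := by
    have := h.iid.isProbabilityMeasure
    exact memLp_queryNoise h.oracle (hX.mono (h.iid.sampleAlgebra_le _) le_rfl)
      (h.iid.measurable _ _ _) (h.iid.law _ _ _) (h.iid.indepFun notMem_pastIndices hX)

lemma sampleL2_x_of_sampleL2_z {t : ℕ} {m : Fin M} (hZ : SampleL2 r.ξ μ {j | j.1 ≤ t} (r.z t m))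
    (ℓ : ℕ) : SampleL2 r.ξ μ (pastIndices M t ℓ) (r.x t m ℓ) := by
  induction ℓ with
  | zero => exact hZ.mono setOf_le_subset_pastIndices
  | succ ℓ ih =>
    have hX := ih.mono (pastIndices_mono ℓ.le_succ)
    have hnoise : SampleL2 r.ξ μ (pastIndices M t (ℓ + 1)) (r.noise t m ℓ) :=
      h.sampleL2_noise_of_measurable ih.measurable (pastIndices_mono ℓ.le_succ)
        (Or.inr ⟨rfl, le_rfl⟩)
    rw [funext (r.x_succ t m ℓ)]
    exact hX.sub ((((h.sampleL2_comp hX.measurable).add hnoise).add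
      ((hX.sub (hZ.mono setOf_le_subset_pastIndices)).const_smul _)).const_smul _)

lemma sampleL2_z (t : ℕ) (m : Fin M) : SampleL2 r.ξ μ {j | j.1 ≤ t} (r.z t m) := by
  induction t generalizing m with
  | zero =>
    have := h.iid.isProbabilityMeasure
    exact ⟨measurable_const, memLp_const (0 : Vec d)⟩
  | succ t ih =>
    have hlocal : ∀ m, SampleL2 r.ξ μ {j | j.1 ≤ t + 1} (r.zLocal t m) := fun m => by
      have hX := h.sampleL2_x_of_sampleL2_z (ih m) r.H
      exact ((ih m).mono fun j hj => Nat.le_succ_of_le hj).sub (((h.sampleL2_comp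
        (hX.mono pastIndices_subset_setOf_le).measurable).add (h.sampleL2_noise_of_measurable
          hX.measurable pastIndices_subset_setOf_le (le_refl (t + 1)))).const_smul _)
    rw [funext (r.z_succ t m)]
    split_ifs
    · exact (SampleL2.sum _ fun m' _ => hlocal m').const_smul _
    · exact hlocal m

lemma sampleL2_z_past (t : ℕ) (m : Fin M) (ℓ : ℕ) :
    SampleL2 r.ξ μ (pastIndices M t ℓ) (r.z t m) :=
  (h.sampleL2_z t m).mono setOf_le_subset_pastIndices

lemma sampleL2_x (t : ℕ) (m : Fin M) (ℓ : ℕ) :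
    SampleL2 r.ξ μ (pastIndices M t ℓ) (r.x t m ℓ) :=
  h.sampleL2_x_of_sampleL2_z (h.sampleL2_z t m) ℓ

lemma sampleL2_V_x (t : ℕ) (m : Fin M) (ℓ : ℕ) :
    SampleL2 r.ξ μ (pastIndices M t ℓ) (fun ω => r.V (r.x t m ℓ ω)) :=
  h.sampleL2_comp (h.sampleL2_x t m ℓ).measurable

lemma p_add_smul (t : ℕ) (m : Fin M) (ω : Ω) :
    r.p t m ω + r.η • r.V (r.p t m ω) = r.z t m ω :=
  resolvent_add_smul h.mono h.smooth h.η_pos.le h.ηL_nonneg _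

lemma sampleL2_p (t : ℕ) (m : Fin M) (ℓ : ℕ) :
    SampleL2 r.ξ μ (pastIndices M t ℓ) (r.p t m) := by
  have hZ := h.sampleL2_z_past t m ℓ
  have hp := (continuous_resolvent h.mono h.smooth h.η_pos.le h.ηL_nonneg).measurable.comp
    hZ.measurable
  have hsub : r.p t m = fun ω => r.z t m ω - r.η • r.V (r.p t m ω) :=
    funext fun ω => eq_sub_of_add_eq (h.p_add_smul t m ω)
  exact hsub ▸ hZ.sub ((h.sampleL2_comp hp).const_smul _)

lemma norm_z_sub_p_le (t : ℕ) (m : Fin M) (ω : Ω) : ‖r.z t m ω - r.p t m ω‖ ≤ r.η * G := by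
  rw [← h.p_add_smul t m ω, add_sub_cancel_left, norm_smul, Real.norm_of_nonneg h.η_pos.le]
  exact mul_le_mul_of_nonneg_left (h.bound _) h.η_pos.le

lemma memLp_noise (t : ℕ) (m : Fin M) (ℓ : ℕ) : MemLp (r.noise t m ℓ) 2 μ :=
  (h.sampleL2_noise_of_measurable (h.sampleL2_x t m ℓ).measurable (Set.subset_univ _)
    (Set.mem_univ _)).memLp

lemma meanLe_noise_sq (t : ℕ) (m : Fin M) (ℓ : ℕ) :
    MeanLe μ (fun ω => ‖r.noise t m ℓ ω‖ ^ 2) (σ ^ 2) := by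
  have := h.iid.isProbabilityMeasure
  have hX := (h.sampleL2_x t m ℓ).measurable
  exact meanLe_queryNoise_sq h.oracle (hX.mono (h.iid.sampleAlgebra_le _) le_rfl)
    (h.iid.measurable _ _ _) (h.iid.law _ _ _) (h.iid.indepFun notMem_pastIndices hX)

lemma integral_inner_noise {S : Set (ℕ × Fin M × ℕ)} {t : ℕ} {m : Fin M} {ℓ : ℕ} {Y : Ω → Vec d}
    (hS : pastIndices M t ℓ ⊆ S) (hi : (t + 1, m, ℓ + 1) ∉ S) (hY : SampleL2 r.ξ μ S Y) :
    ∫ ω, inner ℝ (Y ω) (r.noise t m ℓ ω) ∂μ = 0 := by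
  have := h.iid.isProbabilityMeasure
  have hX := ((h.sampleL2_x t m ℓ).mono hS).measurable
  exact integral_inner_queryNoise h.oracle (hX.mono (h.iid.sampleAlgebra_le S) le_rfl)
    (hY.measurable.mono (h.iid.sampleAlgebra_le S) le_rfl) (h.iid.measurable _ _ _)
    (h.iid.law _ _ _) (h.iid.indepFun hi (hX.prodMk hY.measurable)) hY.memLp

lemma integral_inner_noise_of_past {t : ℕ} {m : Fin M} {ℓ : ℕ} {Y : Ω → Vec d}
    (hY : SampleL2 r.ξ μ (pastIndices M t ℓ) Y) :
    ∫ ω, inner ℝ (Y ω) (r.noise t m ℓ ω) ∂μ = 0 :=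
  h.integral_inner_noise subset_rfl notMem_pastIndices hY

lemma integral_inner_noise_noise_of_le {t t' : ℕ} {m m' : Fin M} {ℓ : ℕ}
    (hne : (t, m) ≠ (t', m')) (hle : t ≤ t') :
    ∫ ω, inner ℝ (r.noise t m ℓ ω) (r.noise t' m' ℓ ω) ∂μ = 0 := by
  have hsub : pastIndices M t ℓ ⊆ {(t' + 1, m', ℓ + 1)}ᶜ := by
    rintro j hj rfl
    simp only [pastIndices, Set.mem_ofPred_eq] at hj
    omega
  have hmem : (t + 1, m, ℓ + 1) ∈ ({(t' + 1, m', ℓ + 1)}ᶜ : Set (ℕ × Fin M × ℕ)) :=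
    fun hj => hne (by simpa using hj)
  exact h.integral_inner_noise (S := {(t' + 1, m', ℓ + 1)}ᶜ)
    (Set.subset_compl_singleton_iff.2 notMem_pastIndices) (by simp)
    (h.sampleL2_noise_of_measurable (h.sampleL2_x t m ℓ).measurable hsub hmem)

lemma integral_inner_noise_noise {t t' : ℕ} {m m' : Fin M} {ℓ : ℕ} (hne : (t, m) ≠ (t', m')) :
    ∫ ω, inner ℝ (r.noise t m ℓ ω) (r.noise t' m' ℓ ω) ∂μ = 0 := by
  rcases le_total t t' with hle | hle
  · exact h.integral_inner_noise_noise_of_le hne hle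
  · simp_rw [real_inner_comm (r.noise t' m' ℓ _)]
    exact h.integral_inner_noise_noise_of_le hne.symm hle

end IsRegular
end Run

/-! ### Accuracy of the inner loop -/

section Progress

variable {d : ℕ} {V : Vec d → Vec d} {L η : ℝ} {x p z : Vec d}

lemma norm_sub_sq_le {E : Type*} [SeminormedAddCommGroup E] (u v : E) :
    ‖u - v‖ ^ 2 ≤ 2 * (‖u‖ ^ 2 + ‖v‖ ^ 2) :=
  (pow_le_pow_left₀ (norm_nonneg _) (norm_sub_le u v) 2).trans (add_sq_le)

lemma inner_progress_le_five_mul (hsmooth : SmoothOp L V) (hη : 0 ≤ η) (ha : 0 ≤ η * L)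
    (ha1 : η * L ≤ 1) (hp : p + η • V p = z) :
    2 * η * inner ℝ (V x) (x - z) + η ^ 2 * ‖V x‖ ^ 2
      ≤ 5 * ‖x - p‖ ^ 2 - 1 / 2 * ‖z - p‖ ^ 2 := by
  have hprogress := inner_progress_le hsmooth hη hp (x := x)
  have hcoef : (2 * (η * L) + (η * L) ^ 2) * ‖x - p‖ ^ 2 ≤ 3 * ‖x - p‖ ^ 2 := by
    gcongr
    nlinarith
  nlinarith [real_inner_le_norm (z - p) (x - p), sq_nonneg (‖z - p‖ - 2 * ‖x - p‖)]

lemma inner_progress_le_of_drift (hsmooth : SmoothOp L V) (hη : 0 ≤ η) (ha : 0 < η * L)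
    (ha1 : η * L ≤ 1) (hp : p + η • V p = z) {y A n : Vec d} {g : ℝ} (hx : x - p = A - g • n)
    (hA : ‖A‖ ^ 2 ≤ 5 * (η * L) ^ 2 * ‖y - p‖ ^ 2) :
    2 * η * inner ℝ (V x) (x - z) + η ^ 2 * ‖V x‖ ^ 2
      ≤ -(1 - 3 * (η * L)) * ‖z - p‖ ^ 2 + 2 * (η * L) * ‖y - p‖ ^ 2
        + 3 * (η * L) * ‖x - p‖ ^ 2 - 2 * g * inner ℝ (z - p) n := by
  have hprogress := inner_progress_le hsmooth hη hp (x := x)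
  have hinner : inner ℝ (z - p) (x - p) = inner ℝ (z - p) A - g * inner ℝ (z - p) n := by
    rw [hx, inner_sub_right, inner_smul_right]
  have hcoef : (2 * (η * L) + (η * L) ^ 2) * ‖x - p‖ ^ 2 ≤ 3 * (η * L) * ‖x - p‖ ^ 2 := by
    gcongr
    nlinarith
  have hyoung : 2 * (‖z - p‖ * ‖A‖) ≤ 3 * (η * L) * ‖z - p‖ ^ 2 + 2 * (η * L) * ‖y - p‖ ^ 2 := by
    refine le_of_mul_le_mul_left ?_ ha
    nlinarith [sq_nonneg (3 * (η * L) * ‖z - p‖ - ‖A‖), sq_nonneg ((η * L) * ‖y - p‖)]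
  linarith [real_inner_le_norm (z - p) A]

end Progress

lemma five_mul_pow_sub_half_le (H : ℕ) : 5 * (5 / 8 : ℝ) ^ H - 1 / 2 ≤ 360 / 4 ^ H := by
  rcases le_or_gt 5 H with hH | hH
  · have hpow : (5 / 8 : ℝ) ^ H ≤ (5 / 8) ^ 5 :=
      pow_le_pow_of_le_one (by norm_num) (by norm_num) hH
    have hnonneg : (0 : ℝ) ≤ 360 / 4 ^ H := by positivity
    norm_num at hpow
    linarith
  · interval_cases H <;> norm_num

namespace Run

variable {d M : ℕ} {Ω Ξ : Type*} (r : Run d M Ω Ξ) (t : ℕ) (m : Fin M)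

/-- The noiseless part of `x_{t+1,ℓ+1}^m - p`, where `p` is the resolvent point of `z_t^m`. -/
def drift (ℓ : ℕ) (ω : Ω) : Vec d :=
  (1 - innerRatio (r.η * r.L)) • (r.x t m ℓ ω - r.p t m ω)
    - (r.η * innerRatio (r.η * r.L)) • (r.V (r.x t m ℓ ω) - r.V (r.p t m ω))

/-- The part of `2 η ⟨V x, x - w⟩`, with `x = x_{t+1}^m`, that is left after the expansion of the
squared distance of the next iterate to `w`. -/
def progress (ω : Ω) : ℝ :=
  2 * r.η * inner ℝ (r.V (r.x t m r.H ω)) (r.x t m r.H ω - r.z t m ω)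
    + r.η ^ 2 * ‖r.V (r.x t m r.H ω)‖ ^ 2

variable [MeasurableSpace Ω]

/-- Mean squared length of the resolvent step at `z_t^m`. -/
def resolventStep (μ : Measure Ω) : ℝ := ∫ ω, ‖r.z t m ω - r.p t m ω‖ ^ 2 ∂μ

variable {r t m} in
lemma resolventStep_nonneg {μ : Measure Ω} : 0 ≤ r.resolventStep t m μ :=
  integral_nonneg fun _ => sq_nonneg _

namespace IsRegular

variable {r} (ℓ : ℕ) [MeasurableSpace Ξ] {μ : Measure Ω} {P : Measure Ξ} {G σ : ℝ}
  (h : r.IsRegular μ P G σ)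
include h

lemma ηL_pos : 0 < r.η * r.L := mul_pos h.η_pos h.L_pos

lemma memLp_x_sub_p : MemLp (fun ω => r.x t m ℓ ω - r.p t m ω) 2 μ :=
  ((h.sampleL2_x t m ℓ).sub (h.sampleL2_p t m ℓ)).memLp

lemma sampleL2_z_sub_p :
    SampleL2 r.ξ μ (pastIndices M t ℓ) (fun ω => r.z t m ω - r.p t m ω) :=
  (h.sampleL2_z_past t m ℓ).sub (h.sampleL2_p t m ℓ)

lemma meanLe_z_sub_p :
    MeanLe μ (fun ω => ‖r.z t m ω - r.p t m ω‖ ^ 2) (r.resolventStep t m μ) :=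
  ⟨integrable_norm_sq (h.sampleL2_z_sub_p t m 0).memLp, le_rfl⟩

lemma resolventStep_le : r.resolventStep t m μ ≤ r.η ^ 2 * G ^ 2 := by
  have := h.iid.isProbabilityMeasure
  calc r.resolventStep t m μ ≤ ∫ _, (r.η * G) ^ 2 ∂μ :=
        integral_mono (h.meanLe_z_sub_p t m).integrable (integrable_const _) fun ω =>
          pow_le_pow_left₀ (norm_nonneg _) (h.norm_z_sub_p_le t m ω) 2
    _ = r.η ^ 2 * G ^ 2 := by simp [mul_pow]

lemma sampleL2_drift : SampleL2 r.ξ μ (pastIndices M t ℓ) (r.drift t m ℓ) :=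
  (((h.sampleL2_x t m ℓ).sub (h.sampleL2_p t m ℓ)).const_smul _).sub
    (((h.sampleL2_V_x t m ℓ).sub (h.sampleL2_comp (h.sampleL2_p t m ℓ).measurable)).const_smul _)

lemma norm_drift_sq_le (ω : Ω) :
    ‖r.drift t m ℓ ω‖ ^ 2
      ≤ contractionFactor (r.η * r.L) * ‖r.x t m ℓ ω - r.p t m ω‖ ^ 2 :=
  norm_sq_innerStep_le h.mono h.smooth h.η_pos.le h.ηL_nonneg _ _

lemma x_succ_sub_p (ω : Ω) :
    r.x t m (ℓ + 1) ω - r.p t m ω =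
      r.drift t m ℓ ω - (r.η * innerRatio (r.η * r.L)) • r.noise t m ℓ ω := by
  have hcancel : (r.η * innerRatio (r.η * r.L)) • (1 / r.η) • (r.x t m ℓ ω - r.z t m ω)
      = innerRatio (r.η * r.L) • (r.x t m ℓ ω - r.z t m ω) := by
    rw [smul_smul, mul_one_div, mul_div_cancel_left₀ _ h.η_pos.ne']
  rw [r.x_succ, innerStepSize_eq h.ηL_nonneg h.η_pos, drift, smul_add, hcancel,
    ← h.p_add_smul t m ω]
  module

lemma meanLe_x_succ_sub_p {b : ℝ} (hb : MeanLe μ (fun ω => ‖r.x t m ℓ ω - r.p t m ω‖ ^ 2) b) :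
    MeanLe μ (fun ω => ‖r.x t m (ℓ + 1) ω - r.p t m ω‖ ^ 2)
      (contractionFactor (r.η * r.L) * b
        + (r.η * innerRatio (r.η * r.L)) ^ 2 * σ ^ 2) := by
  have hdrift := (hb.const_mul (contractionFactor_nonneg (r.η * r.L))).mono
    (integrable_norm_sq (h.sampleL2_drift t m ℓ).memLp) (h.norm_drift_sq_le t m ℓ) le_rfl
  refine ⟨integrable_norm_sq (h.memLp_x_sub_p t m (ℓ + 1)), ?_⟩
  simp_rw [h.x_succ_sub_p t m ℓ]
  rw [integral_norm_sub_smul_sq (h.sampleL2_drift t m ℓ).memLp (h.memLp_noise t m ℓ)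
    (h.integral_inner_noise_of_past (h.sampleL2_drift t m ℓ))]
  gcongr
  exacts [hdrift.integral_le, (h.meanLe_noise_sq t m ℓ).integral_le]

lemma meanLe_x_sub_p_innerRatio :
    MeanLe μ (fun ω => ‖r.x t m ℓ ω - r.p t m ω‖ ^ 2)
      (contractionFactor (r.η * r.L) ^ ℓ * r.resolventStep t m μ
        + innerRatio (r.η * r.L) * (r.η ^ 2 * σ ^ 2)) := by
  induction ℓ with
  | zero =>
    refine (h.meanLe_z_sub_p t m).trans_le ?_
    rw [pow_zero, one_mul]
    exact le_add_of_nonneg_right (mul_nonneg (innerRatio_nonneg _) (by positivity))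
  | succ ℓ ih =>
    refine (h.meanLe_x_succ_sub_p t m ℓ ih).trans_le ?_
    have hnoise : 0 ≤ innerRatio (r.η * r.L) * (r.η ^ 2 * σ ^ 2) :=
      mul_nonneg (innerRatio_nonneg _) (by positivity)
    have := mul_le_mul_of_nonneg_right (contractionFactor_le_one_sub h.ηL_nonneg) hnoise
    rw [pow_succ (contractionFactor _)]
    linarith

lemma meanLe_x_sub_p :
    MeanLe μ (fun ω => ‖r.x t m ℓ ω - r.p t m ω‖ ^ 2)
      (contractionFactor (r.η * r.L) ^ ℓ * r.resolventStep t m μ + r.η ^ 2 * σ ^ 2) :=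
  (h.meanLe_x_sub_p_innerRatio t m ℓ).trans_le
    (add_le_add_right (mul_le_of_le_one_left (by positivity) (innerRatio_le_one h.ηL_nonneg)) _)

lemma meanLe_x_sub_p_resolventStep :
    MeanLe μ (fun ω => ‖r.x t m ℓ ω - r.p t m ω‖ ^ 2)
      (r.resolventStep t m μ + r.η ^ 2 * σ ^ 2) := by
  refine (h.meanLe_x_sub_p t m ℓ).trans_le ?_
  gcongr
  exact mul_le_of_le_one_left resolventStep_nonneg
    (pow_le_one₀ (contractionFactor_nonneg _) (contractionFactor_lt_one h.ηL_nonneg).le)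

lemma meanLe_x_sub_z :
    MeanLe μ (fun ω => ‖r.x t m ℓ ω - r.z t m ω‖ ^ 2)
      (4 * r.resolventStep t m μ + 2 * (r.η ^ 2 * σ ^ 2)) := by
  refine (((h.meanLe_x_sub_p_resolventStep t m ℓ).add
      (h.meanLe_z_sub_p t m)).const_mul zero_le_two).mono
    (integrable_norm_sq ((h.sampleL2_x t m ℓ).sub (h.sampleL2_z_past t m ℓ)).memLp)
    (fun ω => ?_) (by linarith)
  rw [← sub_sub_sub_cancel_right _ _ (r.p t m ω)]
  exact norm_sub_sq_le _ _

lemma integrable_progress : Integrable (r.progress t m) μ :=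
  ((integrable_inner (h.sampleL2_V_x t m r.H).memLp
    ((h.sampleL2_x t m r.H).sub (h.sampleL2_z_past t m r.H)).memLp).const_mul _).add
    ((integrable_norm_sq (h.sampleL2_V_x t m r.H).memLp).const_mul _)

lemma meanLe_progress :
    MeanLe μ (r.progress t m) (5 * (r.η ^ 2 * σ ^ 2) + 360 * (r.η ^ 2 * G ^ 2) / 4 ^ r.H) := by
  have hq : contractionFactor (r.η * r.L) ^ r.H ≤ (5 / 8) ^ r.H :=
    pow_le_pow_left₀ (contractionFactor_nonneg _) (contractionFactor_le h.ηL_nonneg h.ηL_le) _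
  have hbias : (5 * (5 / 8) ^ r.H - 1 / 2) * r.resolventStep t m μ
      ≤ 360 / 4 ^ r.H * (r.η ^ 2 * G ^ 2) :=
    mul_le_mul (five_mul_pow_sub_half_le _) (h.resolventStep_le t m) resolventStep_nonneg
      (by positivity)
  refine (((h.meanLe_x_sub_p t m r.H).const_mul (by norm_num : (0 : ℝ) ≤ 5)).add
    (MeanLe.of_integral (h.meanLe_z_sub_p t m).integrable (-(1 / 2)))).mono
    (h.integrable_progress t m) (fun ω => ?_) ?_
  · have := inner_progress_le_five_mul h.smooth h.η_pos.le h.ηL_nonneg h.ηL_le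
      (h.p_add_smul t m ω) (x := r.x t m r.H ω)
    rw [progress]
    linarith
  · have := mul_le_mul_of_nonneg_right hq (resolventStep_nonneg (r := r) (t := t) (m := m) (μ := μ))
    rw [← resolventStep, mul_div_right_comm]
    linarith

lemma meanLe_progress_of_H_eq_zero (hH : r.H = 0) :
    MeanLe μ (r.progress t m) (r.η ^ 2 * G ^ 2) := by
  have := h.iid.isProbabilityMeasure
  refine MeanLe.mono (g := fun _ => r.η ^ 2 * G ^ 2) ⟨integrable_const _, by simp⟩
    (h.integrable_progress t m) (fun ω => ?_) le_rfl
  have hx : r.x t m r.H ω = r.z t m ω := by rw [hH]; rfl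
  rw [progress, hx, sub_self, inner_zero_right, mul_zero, zero_add]
  exact mul_le_mul_of_nonneg_left (pow_le_pow_left₀ (norm_nonneg _) (h.bound _) 2) (sq_nonneg _)

lemma progress_le_of_H_eq_succ (hH : r.H = ℓ + 1) (ω : Ω) :
    r.progress t m ω ≤
      -(1 - 3 * (r.η * r.L)) * ‖r.z t m ω - r.p t m ω‖ ^ 2
        + 2 * (r.η * r.L) * ‖r.x t m ℓ ω - r.p t m ω‖ ^ 2
        + 3 * (r.η * r.L) * ‖r.x t m (ℓ + 1) ω - r.p t m ω‖ ^ 2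
        - 2 * (r.η * innerRatio (r.η * r.L)) *
          inner ℝ (r.z t m ω - r.p t m ω) (r.noise t m ℓ ω) := by
  rw [progress, hH]
  exact inner_progress_le_of_drift h.smooth h.η_pos.le h.ηL_pos h.ηL_le (h.p_add_smul t m ω)
    (h.x_succ_sub_p t m ℓ ω) ((h.norm_drift_sq_le t m ℓ ω).trans (mul_le_mul_of_nonneg_right
      (contractionFactor_le_five_mul_sq h.ηL_nonneg) (sq_nonneg _)))

lemma meanLe_progress_of_H_eq_succ (hH : r.H = ℓ + 1) :
    MeanLe μ (r.progress t m)
      (-(1 - 8 * (r.η * r.L)) * r.resolventStep t m μ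
        + 5 * (r.η * r.L) * (r.η ^ 2 * σ ^ 2)) := by
  have ha := h.ηL_nonneg
  have hzp := h.sampleL2_z_sub_p t m ℓ
  have hnoise := integrable_inner hzp.memLp (h.memLp_noise t m ℓ)
  have hbound := (((MeanLe.of_integral (h.meanLe_z_sub_p t m).integrable
    (-(1 - 3 * (r.η * r.L)))).add
    ((h.meanLe_x_sub_p_resolventStep t m ℓ).const_mul (by positivity : 0 ≤ 2 * (r.η * r.L)))).add
    ((h.meanLe_x_sub_p_resolventStep t m (ℓ + 1)).const_mul
      (by positivity : 0 ≤ 3 * (r.η * r.L)))).add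
    (MeanLe.of_integral hnoise (-(2 * (r.η * innerRatio (r.η * r.L)))))
  refine hbound.mono (h.integrable_progress t m) (fun ω => ?_) ?_
  · linarith [h.progress_le_of_H_eq_succ t m ℓ hH ω]
  · rw [h.integral_inner_noise_of_past hzp, ← resolventStep]
    linarith

lemma meanLe_progress_resolventStep :
    MeanLe μ (r.progress t m)
      (-(1 - 8 * (r.η * r.L)) * r.resolventStep t m μ + 5 * (r.η * r.L) * (r.η ^ 2 * σ ^ 2)
        + 2 * (r.η ^ 2 * G ^ 2) / 4 ^ r.H) := by
  have ha := h.ηL_nonneg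
  have hR := h.resolventStep_le t m
  have hR0 := resolventStep_nonneg (r := r) (t := t) (m := m) (μ := μ)
  rcases hH : r.H with _ | k
  · refine (h.meanLe_progress_of_H_eq_zero t m hH).trans_le ?_
    have hσ : 0 ≤ 5 * (r.η * r.L) * (r.η ^ 2 * σ ^ 2) := by positivity
    rw [pow_zero, div_one]
    nlinarith
  · exact (h.meanLe_progress_of_H_eq_succ t m k hH).trans_le
      (le_add_of_nonneg_right (by positivity))

end IsRegular
end Run

/-! ### From regret to the gap -/

section Average

variable {ι E : Type*} [Fintype ι] [NormedAddCommGroup E] [InnerProductSpace ℝ E]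

/-- The average of a finite family of vectors. -/
def avg (y : ι → E) : E := (1 / (Fintype.card ι : ℝ)) • ∑ i, y i

lemma card_smul_avg (y : ι → E) : (Fintype.card ι : ℝ) • avg y = ∑ i, y i := by
  cases isEmpty_or_nonempty ι
  · simp
  · rw [avg, smul_smul, mul_one_div_cancel (Nat.cast_ne_zero.2 Fintype.card_ne_zero), one_smul]

lemma avg_const [Nonempty ι] (w : E) : avg (fun _ : ι => w) = w := by
  rw [avg, Finset.sum_const, Finset.card_univ, ← Nat.cast_smul_eq_nsmul ℝ, smul_smul,
    one_div_mul_cancel (Nat.cast_ne_zero.2 Fintype.card_ne_zero), one_smul]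

lemma sum_sub_avg (y : ι → E) : ∑ i, (y i - avg y) = 0 := by
  rw [Finset.sum_sub_distrib, Finset.sum_const, Finset.card_univ, ← Nat.cast_smul_eq_nsmul ℝ,
    card_smul_avg, sub_self]

lemma avg_add (x y : ι → E) : avg (fun i => x i + y i) = avg x + avg y := by
  rw [avg, Finset.sum_add_distrib, smul_add, ← avg, ← avg]

lemma avg_sub_smul (x y : ι → E) (c : ℝ) : avg (fun i => x i - c • y i) = avg x - c • avg y := by
  rw [avg, Finset.sum_sub_distrib, smul_sub, ← Finset.smul_sum, smul_comm _ c, ← avg, ← avg]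

lemma sum_norm_sub_sq (y : ι → E) (w : E) :
    ∑ i, ‖y i - w‖ ^ 2 = ∑ i, ‖y i - avg y‖ ^ 2 + Fintype.card ι * ‖avg y - w‖ ^ 2 := by
  have hexpand : ∀ i, ‖y i - w‖ ^ 2
      = ‖y i - avg y‖ ^ 2 + 2 * inner ℝ (y i - avg y) (avg y - w) + ‖avg y - w‖ ^ 2 := fun i => by
    rw [← norm_add_sq_real, sub_add_sub_cancel]
  simp_rw [hexpand]
  rw [Finset.sum_add_distrib, Finset.sum_add_distrib, ← Finset.mul_sum, ← sum_inner, sum_sub_avg,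
    inner_zero_left, mul_zero, add_zero, Finset.sum_const, Finset.card_univ, nsmul_eq_mul]

lemma sum_norm_sub_avg_sq_le (y : ι → E) (w : E) :
    ∑ i, ‖y i - avg y‖ ^ 2 ≤ ∑ i, ‖y i - w‖ ^ 2 := by
  rw [sum_norm_sub_sq y w]
  exact le_add_of_nonneg_right (by positivity)

lemma card_mul_norm_avg_sub_sq_le (y : ι → E) (w : E) :
    Fintype.card ι * ‖avg y - w‖ ^ 2 ≤ ∑ i, ‖y i - w‖ ^ 2 := by
  rw [sum_norm_sub_sq y w]
  exact le_add_of_nonneg_left (by positivity)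

lemma card_mul_norm_avg_sq_le (y : ι → E) :
    Fintype.card ι * ‖avg y‖ ^ 2 ≤ ∑ i, ‖y i‖ ^ 2 := by
  simpa only [sub_zero] using card_mul_norm_avg_sub_sq_le y 0

end Average

section Gap

variable {d : ℕ} {V : Vec d → Vec d} {G D : ℝ}

lemma inner_sub_le_of_mem_closedBall (hG : ∀ x, ‖V x‖ ≤ G) (x : Vec d)
    (z : Metric.closedBall (0 : Vec d) D) :
    inner ℝ (V z) (x - z) ≤ G * (‖x‖ + D) := by
  have hz : ‖(z : Vec d)‖ ≤ D := mem_closedBall_zero_iff.1 z.2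
  calc inner ℝ (V z) (x - z) ≤ ‖V z‖ * ‖x - z‖ := real_inner_le_norm _ _
    _ ≤ G * (‖x‖ + D) := mul_le_mul (hG _) ((norm_sub_le _ _).trans (add_le_add_right hz _))
        (norm_nonneg _) ((norm_nonneg _).trans (hG 0))

lemma bddAbove_gap (hG : ∀ x, ‖V x‖ ≤ G) (x : Vec d) :
    BddAbove (Set.range fun z : Metric.closedBall (0 : Vec d) D => inner ℝ (V z) (x - z)) :=
  ⟨G * (‖x‖ + D), Set.forall_mem_range.2 (inner_sub_le_of_mem_closedBall hG x)⟩

lemma gap_le (hD : 0 ≤ D) {x : Vec d} {B : ℝ}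
    (h : ∀ w : Vec d, ‖w‖ ≤ D → inner ℝ (V w) (x - w) ≤ B) : gap V D x ≤ B := by
  have : Nonempty (Metric.closedBall (0 : Vec d) D) := ⟨⟨0, Metric.mem_closedBall_self hD⟩⟩
  exact ciSup_le fun z => h z (mem_closedBall_zero_iff.1 z.2)

lemma lipschitzWith_gap (hG : ∀ x, ‖V x‖ ≤ G) (hD : 0 ≤ D) :
    LipschitzWith G.toNNReal (gap V D) := by
  refine LipschitzWith.of_le_add_mul _ fun x y => gap_le hD fun w hw => ?_
  have hgap : inner ℝ (V w) (y - w) ≤ gap V D y :=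
    le_ciSup (bddAbove_gap hG y) (⟨w, mem_closedBall_zero_iff.2 hw⟩ : Metric.closedBall _ D)
  have hdist : inner ℝ (V w) (x - y) ≤ G * ‖x - y‖ :=
    (real_inner_le_norm _ _).trans (mul_le_mul_of_nonneg_right (hG w) (norm_nonneg _))
  rw [Real.coe_toNNReal _ ((norm_nonneg _).trans (hG 0)), dist_eq_norm,
    ← sub_add_sub_cancel x y w, inner_add_right]
  linarith

lemma integrable_gap {Ω : Type*} [MeasurableSpace Ω] {μ : Measure Ω} [IsFiniteMeasure μ]
    (hG : ∀ x, ‖V x‖ ≤ G) (hD : 0 ≤ D) {X : Ω → Vec d} (hX : Integrable X μ) :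
    Integrable (fun ω => gap V D (X ω)) μ := by
  have hlip := lipschitzWith_gap hG hD
  refine ((integrable_const |gap V D 0|).add (hX.norm.const_mul G)).mono'
    (hlip.continuous.comp_aestronglyMeasurable hX.1) (.of_forall fun ω => ?_)
  have hdist := hlip.dist_le_mul (X ω) 0
  rw [Real.dist_eq, dist_zero_right, Real.coe_toNNReal _ ((norm_nonneg _).trans (hG 0))] at hdist
  have htriangle := abs_sub_abs_le_abs_sub (gap V D (X ω)) (gap V D 0)
  simp only [Pi.add_apply, Real.norm_eq_abs]
  linarith

end Gap

section StepIdentity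

variable {E : Type*} [NormedAddCommGroup E] [InnerProductSpace ℝ E]

/-- The contribution of the error `e` of the oracle to the regret of the step
`z ↦ z - η • (v + e)`. -/
def noiseCost (η : ℝ) (z v e : E) : ℝ :=
  η ^ 2 * ‖e‖ ^ 2 + 2 * η ^ 2 * inner ℝ v e + -(2 * η) * inner ℝ z e

lemma two_mul_inner_sub_eq (η : ℝ) (z x v e w : E) :
    2 * η * inner ℝ v (x - w) = ‖z - w‖ ^ 2 - ‖z - η • (v + e) - w‖ ^ 2
      + (2 * η * inner ℝ v (x - z) + η ^ 2 * ‖v‖ ^ 2) + noiseCost η z v e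
      + 2 * η * inner ℝ e w := by
  rw [noiseCost, sub_right_comm, norm_sub_sq_real (z - w), norm_smul, inner_smul_right, mul_pow,
    Real.norm_eq_abs, sq_abs, norm_add_sq_real]
  simp only [inner_sub_right, inner_sub_left, inner_add_right, real_inner_comm v z,
    real_inner_comm v w, real_inner_comm e w]
  ring

variable {Ω : Type*} [MeasurableSpace Ω] {μ : Measure Ω} {Z W N : Ω → E}

lemma meanLe_noiseCost (hZ : MemLp Z 2 μ) (hW : MemLp W 2 μ) (hN : MemLp N 2 μ)
    (hZN : ∫ ω, inner ℝ (Z ω) (N ω) ∂μ = 0) (hWN : ∫ ω, inner ℝ (W ω) (N ω) ∂μ = 0) {s : ℝ}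
    (hs : MeanLe μ (fun ω => ‖N ω‖ ^ 2) s) (η : ℝ) :
    MeanLe μ (fun ω => noiseCost η (Z ω) (W ω) (N ω)) (η ^ 2 * s) :=
  (((hs.const_mul (sq_nonneg η)).add (MeanLe.of_integral (integrable_inner hW hN) _)).add
    (MeanLe.of_integral (integrable_inner hZ hN) _)).trans_le (by simp [hZN, hWN])

end StepIdentity

lemma sum_range_le_of_le_sub_add {a b φ : ℕ → ℝ} (h : ∀ t, a t ≤ φ t - φ (t + 1) + b t) (T : ℕ) :
    ∑ t ∈ Finset.range T, a t ≤ φ 0 - φ T + ∑ t ∈ Finset.range T, b t := by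
  rw [← Finset.sum_range_sub', ← Finset.sum_add_distrib]
  exact Finset.sum_le_sum fun t _ => h t

namespace Run

section Iterates

variable {d M : ℕ} {Ω Ξ : Type*} (r : Run d M Ω Ξ) (t : ℕ) (ω : Ω)

/-- The output of LIPPAX after `T` rounds. -/
def output (T : ℕ) : Vec d :=
  lippaxOutput r.Vt r.η (innerStepSize r.L r.η) r.H r.K T (fun t m ℓ => r.ξ t m ℓ ω)

/-- The average over the machines of the oracle errors in the outer step of round `t + 1`. -/
def noiseMean : Vec d := avg fun m => r.noise t m r.H ω

/-- The regret of round `t + 1` against the comparator `w`, summed over the machines and scaled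
by `2 η`. -/
def regret (w : Vec d) : ℝ :=
  ∑ m, 2 * r.η * inner ℝ (r.V (r.x t m r.H ω)) (r.x t m r.H ω - w)

lemma output_eq (T : ℕ) :
    r.output ω T =
      (1 / ((M : ℝ) * T)) • ∑ t ∈ Finset.range T, ∑ m, r.x t m r.H ω := by
  rw [output, lippaxOutput, Finset.sum_comm, Finset.range_eq_Ico]
  congr 1
  exact (Finset.sum_Ico_add' (fun t => ∑ m, lippaxX r.Vt r.η (innerStepSize r.L r.η) r.H r.K
    (fun t m ℓ => r.ξ t m ℓ ω) t m) 0 T 1).symm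

lemma noiseMean_eq : r.noiseMean t ω = (1 / (M : ℝ)) • ∑ m, r.noise t m r.H ω := by
  rw [noiseMean, avg, Fintype.card_fin]

lemma z_succ_of_mod_eq_zero (m : Fin M) (ht : (t + 1) % r.K = 0) :
    r.z (t + 1) m ω = avg fun m' => r.zLocal t m' ω := by
  rw [r.z_succ, if_pos ht, avg, Fintype.card_fin]

lemma z_succ_of_mod_ne_zero (m : Fin M) (ht : (t + 1) % r.K ≠ 0) :
    r.z (t + 1) m ω = r.zLocal t m ω := by
  rw [r.z_succ, if_neg ht]

lemma sum_norm_z_succ_sub_sq_le (w : Vec d) :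
    ∑ m, ‖r.z (t + 1) m ω - w‖ ^ 2 ≤ ∑ m, ‖r.zLocal t m ω - w‖ ^ 2 := by
  by_cases ht : (t + 1) % r.K = 0
  · simp_rw [r.z_succ_of_mod_eq_zero t ω _ ht]
    simpa using card_mul_norm_avg_sub_sq_le (fun m => r.zLocal t m ω) w
  · simp_rw [r.z_succ_of_mod_ne_zero t ω _ ht]
    exact le_rfl

lemma inner_output_sub {T : ℕ} (hM : 0 < M) (hT : 0 < T) (v w : Vec d) :
    2 * r.η * (M * T) * inner ℝ v (r.output ω T - w) =
      ∑ t ∈ Finset.range T, ∑ m, 2 * r.η * inner ℝ v (r.x t m r.H ω - w) := by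
  have hM' : (M : ℝ) ≠ 0 := Nat.cast_ne_zero.2 hM.ne'
  have hT' : (T : ℝ) ≠ 0 := Nat.cast_ne_zero.2 hT.ne'
  simp_rw [inner_sub_right, mul_sub, Finset.sum_sub_distrib, ← Finset.mul_sum, ← inner_sum]
  rw [r.output_eq, inner_smul_right]
  simp only [Finset.sum_const, Finset.card_univ, Fintype.card_fin, Finset.card_range,
    ← Nat.cast_smul_eq_nsmul ℝ, inner_smul_right]
  field_simp

lemma card_mul_inner_noiseMean (w : Vec d) :
    M * inner ℝ (r.noiseMean t ω) w = ∑ m, inner ℝ (r.noise t m r.H ω) w := by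
  rw [← sum_inner, ← card_smul_avg, real_inner_smul_left, Fintype.card_fin, noiseMean]

lemma regret_eq (w : Vec d) :
    r.regret t ω w = ∑ m, ‖r.z t m ω - w‖ ^ 2 - ∑ m, ‖r.zLocal t m ω - w‖ ^ 2
      + (∑ m, (r.progress t m ω
        + noiseCost r.η (r.z t m ω) (r.V (r.x t m r.H ω)) (r.noise t m r.H ω))
      + 2 * r.η * (M * inner ℝ (r.noiseMean t ω) w)) := by
  rw [card_mul_inner_noiseMean, Finset.mul_sum, ← Finset.sum_sub_distrib,
    ← Finset.sum_add_distrib, ← Finset.sum_add_distrib]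
  refine Finset.sum_congr rfl fun m _ => ?_
  rw [two_mul_inner_sub_eq r.η (r.z t m ω) _ _ (r.noise t m r.H ω), zLocal, progress]
  ring

end Iterates

variable {d M : ℕ} {Ω Ξ : Type*} [MeasurableSpace Ω] [MeasurableSpace Ξ]

namespace IsRegular

variable {r : Run d M Ω Ξ} {μ : Measure Ω} {P : Measure Ξ} {G σ : ℝ} (h : r.IsRegular μ P G σ)
include h

lemma integral_norm_sum_noise_sq_le (s : Finset (ℕ × Fin M)) :
    ∫ ω, ‖∑ i ∈ s, r.noise i.1 i.2 r.H ω‖ ^ 2 ∂μ ≤ s.card * σ ^ 2 := by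
  rw [integral_norm_sum_sq s (fun i _ => h.memLp_noise i.1 i.2 r.H)
    fun i _ j _ hij => h.integral_inner_noise_noise hij, ← nsmul_eq_mul]
  exact Finset.sum_le_card_nsmul _ _ _ fun i _ => (h.meanLe_noise_sq i.1 i.2 r.H).integral_le

lemma memLp_noiseMean (t : ℕ) : MemLp (r.noiseMean t) 2 μ :=
  (memLp_finsetSum _ fun m _ => h.memLp_noise t m r.H).const_smul (1 / (Fintype.card (Fin M) : ℝ))

lemma meanLe_norm_sum_noiseMean_sq (s : Finset ℕ) :
    MeanLe μ (fun ω => ‖∑ t ∈ s, r.noiseMean t ω‖ ^ 2) (s.card * σ ^ 2 / M) := by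
  have hM := h.M_pos_real
  refine ⟨integrable_norm_sq (memLp_finsetSum _ fun t _ => h.memLp_noiseMean t), ?_⟩
  have hcard := h.integral_norm_sum_noise_sq_le (s ×ˢ Finset.univ)
  simp_rw [Finset.sum_product] at hcard
  rw [Finset.card_product, Finset.card_univ, Fintype.card_fin, Nat.cast_mul] at hcard
  simp_rw [noiseMean_eq, ← Finset.smul_sum, norm_smul, mul_pow]
  rw [integral_const_mul, norm_div, norm_one, Real.norm_natCast]
  refine (mul_le_mul_of_nonneg_left hcard (by positivity)).trans_eq ?_
  field_simp

lemma meanLe_norm_noiseMean_sq (t : ℕ) :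
    MeanLe μ (fun ω => ‖r.noiseMean t ω‖ ^ 2) (σ ^ 2 / M) := by
  simpa using h.meanLe_norm_sum_noiseMean_sq {t}

lemma integral_inner_noiseMean {t : ℕ} {Y : Ω → Vec d}
    (hY : SampleL2 r.ξ μ (pastIndices M t r.H) Y) :
    ∫ ω, inner ℝ (Y ω) (r.noiseMean t ω) ∂μ = 0 := by
  simp_rw [noiseMean_eq, inner_smul_right, inner_sum]
  rw [integral_const_mul, integral_finsetSum _ fun m _ =>
    integrable_inner hY.memLp (h.memLp_noise t m r.H),
    Finset.sum_eq_zero fun m _ => h.integral_inner_noise_of_past hY, mul_zero]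

lemma meanLe_norm_sum_noiseMean (hσ : 0 ≤ σ) (T : ℕ) :
    MeanLe μ (fun ω => ‖∑ t ∈ Finset.range T, r.noiseMean t ω‖) (σ * √(T / M)) := by
  have := h.iid.isProbabilityMeasure
  have hsum : MemLp (fun ω => ∑ t ∈ Finset.range T, r.noiseMean t ω) 2 μ :=
    memLp_finsetSum _ fun t _ => h.memLp_noiseMean t
  have hsq := h.meanLe_norm_sum_noiseMean_sq (Finset.range T)
  rw [Finset.card_range, mul_comm, mul_div_assoc] at hsq
  refine ⟨(hsum.integrable one_le_two).norm,
    (integral_norm_le_sqrt hsum hsq.integral_le).trans_eq ?_⟩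
  rw [Real.sqrt_mul (sq_nonneg σ), Real.sqrt_sq hσ]

lemma integrable_output (T : ℕ) : Integrable (fun ω => r.output ω T) μ := by
  have := h.iid.isProbabilityMeasure
  simp_rw [output_eq]
  exact (integrable_finsetSum _ fun t _ => integrable_finsetSum _ fun m _ =>
    (h.sampleL2_x t m r.H).memLp.integrable one_le_two).smul (1 / ((M : ℝ) * T))

lemma inner_output_sub_le_sum_regret {T : ℕ} (hT : 0 < T) (ω : Ω) (w : Vec d) :
    2 * r.η * (M * T) * inner ℝ (r.V w) (r.output ω T - w) ≤
      ∑ t ∈ Finset.range T, r.regret t ω w := by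
  rw [r.inner_output_sub ω h.M_pos hT]
  refine Finset.sum_le_sum fun t _ => Finset.sum_le_sum fun m _ => ?_
  have hmono := h.mono (r.x t m r.H ω) w
  rw [inner_sub_left] at hmono
  exact mul_le_mul_of_nonneg_left (sub_nonneg.1 hmono) (mul_nonneg zero_le_two h.η_pos.le)

variable {D : ℝ} {T : ℕ} {φ : Vec d → ℕ → Ω → ℝ} {q : ℕ → Ω → ℝ}

lemma gap_output_le (hD : 0 ≤ D) (hT : 0 < T) {ω : Ω} (hφ0 : ∀ w, φ w 0 ω ≤ M * ‖w‖ ^ 2)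
    (hφ : ∀ w, 0 ≤ φ w T ω)
    (hstep : ∀ w t, r.regret t ω w ≤ φ w t ω - φ w (t + 1) ω
      + (q t ω + 2 * r.η * (M * inner ℝ (r.noiseMean t ω) w))) :
    gap r.V D (r.output ω T) ≤ 1 / (2 * r.η * (M * T)) * (M * D ^ 2 +
      ∑ t ∈ Finset.range T, q t ω
      + 2 * r.η * (M * D) * ‖∑ t ∈ Finset.range T, r.noiseMean t ω‖) := by
  have hη := h.η_pos
  have hM := h.M_pos_real
  refine gap_le hD fun w hw => ?_
  rw [one_div_mul_eq_div, le_div_iff₀ (by positivity), mul_comm (inner ℝ _ _)]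
  refine (h.inner_output_sub_le_sum_regret hT ω w).trans ?_
  refine (sum_range_le_of_le_sub_add (hstep w) T).trans ?_
  simp_rw [Finset.sum_add_distrib, ← Finset.mul_sum, ← sum_inner]
  have hinner : inner ℝ (∑ t ∈ Finset.range T, r.noiseMean t ω) w
      ≤ D * ‖∑ t ∈ Finset.range T, r.noiseMean t ω‖ := by
    rw [mul_comm]
    exact (real_inner_le_norm _ _).trans (mul_le_mul_of_nonneg_left hw (norm_nonneg _))
  have hw2 : M * ‖w‖ ^ 2 ≤ M * D ^ 2 := by gcongr
  have hscaled := mul_le_mul_of_nonneg_left hinner (by positivity : 0 ≤ 2 * r.η * M)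
  linarith [hφ0 w, hφ w]

lemma integral_gap_output_le (hD : 0 ≤ D) (hσ : 0 ≤ σ) (hT : 0 < T) {B : ℝ}
    (hφ0 : ∀ w ω, φ w 0 ω ≤ M * ‖w‖ ^ 2) (hφ : ∀ w ω, 0 ≤ φ w T ω)
    (hq : MeanLe μ (fun ω => ∑ t ∈ Finset.range T, q t ω) (T * (2 * r.η * (M * B))))
    (hstep : ∀ w t ω, r.regret t ω w ≤ φ w t ω - φ w (t + 1) ω
      + (q t ω + 2 * r.η * (M * inner ℝ (r.noiseMean t ω) w))) :
    ∫ ω, gap r.V D (r.output ω T) ∂μ ≤ D ^ 2 / (2 * r.η * T) + B + D * σ / √(M * T) := by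
  have := h.iid.isProbabilityMeasure
  have hη := h.η_pos
  have hM := h.M_pos_real
  have hT' : (0 : ℝ) < T := Nat.cast_pos.2 hT
  have hconst : MeanLe μ (fun _ => M * D ^ 2) (M * D ^ 2) := ⟨integrable_const _, by simp⟩
  have hnoise := (h.meanLe_norm_sum_noiseMean hσ T).const_mul
    (by positivity : 0 ≤ 2 * r.η * (M * D))
  refine ((((hconst.add hq).add hnoise).const_mul
    (by positivity : 0 ≤ 1 / (2 * r.η * (M * T)))).mono
    (integrable_gap h.bound hD (h.integrable_output T))
    (fun ω => h.gap_output_le hD hT (fun w => hφ0 w ω) (fun w => hφ w ω) fun w t => hstep w t ω)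
    (le_of_eq ?_)).integral_le
  have hsqrt : σ * √(T / M) = T * (σ / √(M * T)) := by
    rw [Real.sqrt_div hT'.le, Real.sqrt_mul hM.le]
    field_simp
    rw [Real.sq_sqrt hT'.le]
  rw [hsqrt]
  field_simp

/-- Averaging does not increase the sum of the squared distances to the comparator, so it can be
ignored here. -/
lemma integral_gap_output_le_of_local (hD : 0 ≤ D) (hσ : 0 ≤ σ) (hT : 0 < T) :
    ∫ ω, gap r.V D (r.output ω T) ∂μ ≤ D ^ 2 / (2 * r.η * T)
      + (3 * (r.η * σ ^ 2) + 180 * (r.η * G ^ 2) / 4 ^ r.H) + D * σ / √(M * T) := by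
  have hq := MeanLe.sum (μ := μ) (Finset.range T) fun t _ => MeanLe.sum Finset.univ fun m _ =>
    (h.meanLe_progress t m).add (meanLe_noiseCost (h.sampleL2_z_past t m r.H).memLp
      (h.sampleL2_V_x t m r.H).memLp (h.memLp_noise t m r.H)
      (h.integral_inner_noise_of_past (h.sampleL2_z_past t m r.H))
      (h.integral_inner_noise_of_past (h.sampleL2_V_x t m r.H)) (h.meanLe_noise_sq t m r.H) r.η)
  refine h.integral_gap_output_le hD hσ hT (φ := fun w t ω => ∑ m, ‖r.z t m ω - w‖ ^ 2)
    (fun w ω => ?_) (fun w ω => by positivity) (hq.trans_le (le_of_eq ?_)) fun w t ω => ?_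
  · simp [z, lippaxZ]
  · simp only [Finset.sum_const, Finset.card_univ, Fintype.card_fin, Finset.card_range,
      nsmul_eq_mul]
    field_simp
    ring
  · rw [r.regret_eq]
    exact add_le_add_left (sub_le_sub_left (r.sum_norm_z_succ_sub_sq_le t ω w) _) _

end IsRegular
end Run

/-! ### Disagreement of the machines -/

section Reset

lemma add_one_mod_of_ne_zero {n K : ℕ} (hK : 0 < K) (h : (n + 1) % K ≠ 0) :
    (n + 1) % K = n % K + 1 := by
  rw [← Nat.mod_add_mod] at h ⊢
  refine Nat.mod_eq_of_lt (lt_of_le_of_ne (Nat.succ_le_of_lt (Nat.mod_lt n hK)) fun heq => h ?_)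
  rw [heq, Nat.mod_self]

variable {S b : ℕ → ℝ} {c : ℝ} {K : ℕ}

/-- The weight `K - t % K` of the potential is the number of steps left until the next reset. -/
lemma add_potential_succ_le (hK : 0 < K) (hc : 0 ≤ c) (hcK : c * K ≤ 1 / 2) (hS : ∀ t, 0 ≤ S t)
    (hb : ∀ t, 0 ≤ b t) (hreset : ∀ t, t % K = 0 → S t = 0)
    (hstep : ∀ t, S (t + 1) ≤ (1 + c) * S t + b t) (n : ℕ) :
    S n + 2 * (K - ((n + 1) % K : ℕ)) * S (n + 1) ≤
      2 * (K - (n % K : ℕ)) * S n + 2 * K * b n := by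
  have hmod : ((n % K : ℕ) : ℝ) + 1 ≤ K := by exact_mod_cast Nat.mod_lt n hK
  have hbK : 0 ≤ 2 * K * b n := mul_nonneg (by positivity) (hb n)
  by_cases hn : (n + 1) % K = 0
  · rw [hreset _ hn, mul_zero, add_zero]
    exact (le_mul_of_one_le_left (hS n) (by linarith)).trans (le_add_of_nonneg_right hbK)
  · rw [add_one_mod_of_ne_zero hK hn, Nat.cast_add, Nat.cast_one]
    set k : ℝ := K - ((n % K : ℕ) + 1) with hk
    have hkK : k ≤ K := by rw [hk]; linarith [Nat.cast_nonneg (α := ℝ) (n % K)]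
    have hckS : c * k * S n ≤ 1 / 2 * S n := mul_le_mul_of_nonneg_right
      ((mul_le_mul_of_nonneg_left hkK hc).trans hcK) (hS n)
    calc S n + 2 * k * S (n + 1) ≤ S n + 2 * k * ((1 + c) * S n + b n) := by
          gcongr
          exact hstep n
      _ = (1 + 2 * k) * S n + 2 * (c * k * S n) + 2 * (k * b n) := by ring
      _ ≤ (1 + 2 * k) * S n + 2 * (1 / 2 * S n) + 2 * (K * b n) := by
          gcongr
          exact hb n
      _ = 2 * (K - (n % K : ℕ)) * S n + 2 * K * b n := by rw [hk]; ring

lemma sum_le_of_reset (hK : 0 < K) (hc : 0 ≤ c) (hcK : c * K ≤ 1 / 2) (hS : ∀ t, 0 ≤ S t)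
    (hb : ∀ t, 0 ≤ b t) (hreset : ∀ t, t % K = 0 → S t = 0)
    (hstep : ∀ t, S (t + 1) ≤ (1 + c) * S t + b t) (T : ℕ) :
    ∑ t ∈ Finset.range T, S t ≤ 2 * K * ∑ t ∈ Finset.range T, b t := by
  have hsum := sum_range_le_of_le_sub_add (a := S) (b := fun t => 2 * K * b t)
    (φ := fun t => 2 * (K - (t % K : ℕ)) * S t) (fun t => by
      linarith [add_potential_succ_le hK hc hcK hS hb hreset hstep t]) T
  have hlast : 0 ≤ 2 * (K - (T % K : ℕ)) * S T :=
    mul_nonneg (mul_nonneg zero_le_two (sub_nonneg.2 (by exact_mod_cast (Nat.mod_lt T hK).le)))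
      (hS T)
  rw [← Finset.mul_sum, hreset 0 (Nat.zero_mod K), mul_zero] at hsum
  linarith

end Reset

section RelativeStep

lemma two_mul_mul_le_of_sq_le {a s p q : ℝ} (ha : 0 < a)
    (hs : s ^ 2 ≤ 2 * a ^ 2 * (p + q ^ 2)) : 2 * s * q ≤ 3 * a * q ^ 2 + 2 * a * p := by
  refine le_of_mul_le_mul_left ?_ ha
  nlinarith [sq_nonneg (s - a * q)]

variable {d : ℕ} {V : Vec d → Vec d} {L η : ℝ}

lemma sq_mul_norm_sub_le (h : SmoothOp L V) (x z c : Vec d) :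
    (η * ‖V x - V c‖) ^ 2 ≤ 2 * (η * L) ^ 2 * (‖x - z‖ ^ 2 + ‖z - c‖ ^ 2) := by
  have hxc : ‖x - c‖ ^ 2 ≤ 2 * (‖x - z‖ ^ 2 + ‖z - c‖ ^ 2) := by
    simpa only [sub_sub_sub_cancel_right, norm_sub_rev c z] using norm_sub_sq_le (x - z) (c - z)
  calc (η * ‖V x - V c‖) ^ 2 = η ^ 2 * ‖V x - V c‖ ^ 2 := mul_pow _ _ _
    _ ≤ η ^ 2 * (L * ‖x - c‖) ^ 2 := by gcongr; exact h x c
    _ = (η * L) ^ 2 * ‖x - c‖ ^ 2 := by ring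
    _ ≤ (η * L) ^ 2 * (2 * (‖x - z‖ ^ 2 + ‖z - c‖ ^ 2)) := by gcongr
    _ = _ := by ring

lemma two_mul_norm_mul_norm_le (h : SmoothOp L V) (ha : 0 < η * L) (x z c : Vec d) :
    2 * (η * ‖V x - V c‖) * ‖z - c‖ ≤
      3 * (η * L) * ‖z - c‖ ^ 2 + 2 * (η * L) * ‖x - z‖ ^ 2 :=
  two_mul_mul_le_of_sq_le ha (sq_mul_norm_sub_le h x z c)

lemma two_mul_inner_sub_sub_le (h : SmoothOp L V) (hη : 0 ≤ η) (ha : 0 < η * L) (x z c : Vec d) :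
    2 * η * inner ℝ (V x - V c) (z - c) ≤
      3 * (η * L) * ‖z - c‖ ^ 2 + 2 * (η * L) * ‖x - z‖ ^ 2 := by
  refine le_trans ?_ (two_mul_norm_mul_norm_le h ha x z c)
  rw [mul_assoc, mul_assoc 2, mul_assoc η]
  gcongr
  exact real_inner_le_norm _ _

lemma norm_sub_sub_smul_sq_le (h : SmoothOp L V) (hη : 0 ≤ η) (ha : 0 < η * L) (ha1 : η * L ≤ 1)
    (x z c : Vec d) :
    ‖z - c - η • (V x - V c)‖ ^ 2 ≤
      (1 + 5 * (η * L)) * ‖z - c‖ ^ 2 + 4 * (η * L) * ‖x - z‖ ^ 2 := by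
  have hnorm : ‖z - c - η • (V x - V c)‖ ≤ ‖z - c‖ + η * ‖V x - V c‖ :=
    (norm_sub_le _ _).trans_eq (by rw [norm_smul, Real.norm_of_nonneg hη])
  have hcross := two_mul_norm_mul_norm_le h ha x z c
  have hsq := (sq_mul_norm_sub_le (η := η) h x z c).trans (mul_le_mul_of_nonneg_right
    (mul_le_mul_of_nonneg_left (pow_le_of_le_one ha.le ha1 two_ne_zero) zero_le_two)
    (by positivity))
  calc _ ≤ (‖z - c‖ + η * ‖V x - V c‖) ^ 2 := by gcongr
    _ = ‖z - c‖ ^ 2 + 2 * (η * ‖V x - V c‖) * ‖z - c‖ + (η * ‖V x - V c‖) ^ 2 := by ring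
    _ ≤ _ := by linarith

end RelativeStep

namespace Run

section Iterates

variable {d M : ℕ} {Ω Ξ : Type*} (r : Run d M Ω Ξ) (t : ℕ) (m : Fin M) (ω : Ω)

/-- The average over the machines of the iterates `z_t^m`. -/
def zMean : Vec d := avg fun m => r.z t m ω

/-- The average over the machines of the operator values in the outer step of round `t + 1`. -/
def operatorMean : Vec d := avg fun m => r.V (r.x t m r.H ω)

/-- The squared distances of the machines from their average. -/
def spread : ℝ := ∑ m, ‖r.z t m ω - r.zMean t ω‖ ^ 2

/-- The expected spread of the machines. -/
def disagreement [MeasurableSpace Ω] (μ : Measure Ω) : ℝ := ∫ ω, r.spread t ω ∂μ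

/-- The noiseless outer step of machine `m`, relative to the outer step at the average of the
machines. -/
def relStep : Vec d :=
  r.z t m ω - r.zMean t ω - r.η • (r.V (r.x t m r.H ω) - r.V (r.zMean t ω))

/-- The part of the regret of round `t + 1` that does not telescope along the averages of the
machines. -/
def consensusError : ℝ :=
  ∑ m, r.progress t m ω + 3 * (r.η * r.L) * r.spread t ω
    + 2 * (r.η * r.L) * ∑ m, ‖r.x t m r.H ω - r.z t m ω‖ ^ 2
    + M * noiseCost r.η (r.zMean t ω) (r.operatorMean t ω) (r.noiseMean t ω)

variable {t ω} in
lemma spread_eq_zero {c : Vec d} (hz : ∀ m, r.z t m ω = c) : r.spread t ω = 0 := by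
  refine Finset.sum_eq_zero fun m _ => ?_
  have : Nonempty (Fin M) := ⟨m⟩
  rw [zMean, funext hz, avg_const, hz, sub_self, norm_zero, zero_pow two_ne_zero]

variable {t} in
lemma spread_eq_zero_of_mod_eq_zero (ht : t % r.K = 0) : r.spread t ω = 0 := by
  cases t with
  | zero => exact r.spread_eq_zero fun _ => rfl
  | succ t => exact r.spread_eq_zero fun m => r.z_succ_of_mod_eq_zero t ω m ht

lemma zMean_zero : r.zMean 0 ω = 0 := by
  simp [zMean, avg, z, lippaxZ]

lemma zMean_succ :
    r.zMean (t + 1) ω = r.zMean t ω - r.η • (r.operatorMean t ω + r.noiseMean t ω) := by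
  have hlocal : (avg fun m => r.zLocal t m ω)
      = r.zMean t ω - r.η • (r.operatorMean t ω + r.noiseMean t ω) := by
    simp_rw [zLocal]
    rw [avg_sub_smul, avg_add]
    rfl
  rw [← hlocal, zMean]
  by_cases ht : (t + 1) % r.K = 0
  · simp_rw [r.z_succ_of_mod_eq_zero t ω _ ht]
    cases isEmpty_or_nonempty (Fin M)
    · simp [avg]
    · exact avg_const _
  · simp_rw [r.z_succ_of_mod_ne_zero t ω _ ht]

lemma spread_succ_le :
    r.spread (t + 1) ω ≤ ∑ m, ‖r.relStep t m ω - r.η • r.noise t m r.H ω‖ ^ 2 := by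
  by_cases ht : (t + 1) % r.K = 0
  · rw [r.spread_eq_zero_of_mod_eq_zero ω ht]
    positivity
  · rw [spread, zMean]
    refine (sum_norm_sub_avg_sq_le _ (r.zMean t ω - r.η • r.V (r.zMean t ω))).trans_eq ?_
    refine Finset.sum_congr rfl fun m _ => ?_
    rw [r.z_succ_of_mod_ne_zero t ω m ht, zLocal, relStep]
    congr 2
    module

lemma sum_inner_z_sub_zMean (v : Vec d) : ∑ m, inner ℝ v (r.z t m ω - r.zMean t ω) = 0 := by
  rw [← inner_sum, zMean, sum_sub_avg, inner_zero_right]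

lemma regret_eq_progress_add (w : Vec d) :
    r.regret t ω w =
      ∑ m, (r.progress t m ω - r.η ^ 2 * ‖r.V (r.x t m r.H ω)‖ ^ 2
        + 2 * r.η * inner ℝ (r.V (r.x t m r.H ω) - r.V (r.zMean t ω)) (r.z t m ω - r.zMean t ω))
      + M * (2 * r.η * inner ℝ (r.operatorMean t ω) (r.zMean t ω - w)) := by
  have hmean : M * (2 * r.η * inner ℝ (r.operatorMean t ω) (r.zMean t ω - w)) =
      ∑ m, 2 * r.η * inner ℝ (r.V (r.x t m r.H ω)) (r.zMean t ω - w) := by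
    rw [← Finset.mul_sum, ← sum_inner, ← card_smul_avg, Fintype.card_fin, real_inner_smul_left,
      ← operatorMean]
    ring
  have hzero : ∑ m, 2 * r.η * inner ℝ (r.V (r.zMean t ω)) (r.z t m ω - r.zMean t ω) = 0 := by
    rw [← Finset.mul_sum, sum_inner_z_sub_zMean, mul_zero]
  rw [hmean, ← add_zero (Finset.sum _ _ + _), ← hzero, ← Finset.sum_add_distrib,
    ← Finset.sum_add_distrib]
  refine Finset.sum_congr rfl fun m _ => ?_
  rw [progress]
  simp only [inner_sub_left, inner_sub_right]
  ring

end Iterates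

variable {d M : ℕ} {Ω Ξ : Type*} [MeasurableSpace Ω] [MeasurableSpace Ξ]

namespace IsRegular

variable {r : Run d M Ω Ξ} {μ : Measure Ω} {P : Measure Ξ} {G σ : ℝ} (h : r.IsRegular μ P G σ)
include h

lemma sampleL2_zMean (t : ℕ) : SampleL2 r.ξ μ (pastIndices M t r.H) (r.zMean t) :=
  (SampleL2.sum _ fun m _ => h.sampleL2_z_past t m r.H).const_smul _

lemma sampleL2_operatorMean (t : ℕ) : SampleL2 r.ξ μ (pastIndices M t r.H) (r.operatorMean t) :=
  (SampleL2.sum _ fun m _ => h.sampleL2_V_x t m r.H).const_smul _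

lemma sampleL2_relStep (t : ℕ) (m : Fin M) :
    SampleL2 r.ξ μ (pastIndices M t r.H) (r.relStep t m) :=
  ((h.sampleL2_z_past t m r.H).sub (h.sampleL2_zMean t)).sub
    (((h.sampleL2_V_x t m r.H).sub (h.sampleL2_comp (h.sampleL2_zMean t).measurable)).const_smul _)

lemma meanLe_spread (t : ℕ) : MeanLe μ (r.spread t) (r.disagreement t μ) :=
  ⟨integrable_finsetSum _ fun m _ =>
    integrable_norm_sq ((h.sampleL2_z_past t m r.H).sub (h.sampleL2_zMean t)).memLp, le_rfl⟩

lemma meanLe_sum_norm_relStep_sq (t : ℕ) :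
    MeanLe μ (fun ω => ∑ m, ‖r.relStep t m ω‖ ^ 2)
      ((1 + 5 * (r.η * r.L)) * r.disagreement t μ + 4 * (r.η * r.L) *
        ∑ m, (4 * r.resolventStep t m μ + 2 * (r.η ^ 2 * σ ^ 2))) := by
  have ha := h.ηL_nonneg
  refine (((h.meanLe_spread t).const_mul (by positivity : 0 ≤ 1 + 5 * (r.η * r.L))).add
    ((MeanLe.sum Finset.univ fun m _ => h.meanLe_x_sub_z t m r.H).const_mul
      (by positivity : 0 ≤ 4 * (r.η * r.L)))).mono
    (integrable_finsetSum _ fun m _ => integrable_norm_sq (h.sampleL2_relStep t m).memLp)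
    (fun ω => ?_) le_rfl
  rw [spread, Finset.mul_sum, Finset.mul_sum, ← Finset.sum_add_distrib]
  exact Finset.sum_le_sum fun m _ =>
    norm_sub_sub_smul_sq_le h.smooth h.η_pos.le h.ηL_pos h.ηL_le _ _ _

lemma disagreement_succ_le_integral (t : ℕ) :
    r.disagreement (t + 1) μ ≤
      ∫ ω, ∑ m, ‖r.relStep t m ω‖ ^ 2 ∂μ + M * (r.η ^ 2 * σ ^ 2) := by
  have hrel := fun m => (h.sampleL2_relStep t m).memLp
  have hnoise := fun m => (h.memLp_noise t m r.H).const_smul r.η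
  have hstep : ∀ m ∈ Finset.univ, MeanLe μ
      (fun ω => ‖r.relStep t m ω - r.η • r.noise t m r.H ω‖ ^ 2)
      (∫ ω, ‖r.relStep t m ω‖ ^ 2 ∂μ + r.η ^ 2 * σ ^ 2) := fun m _ => by
    refine ⟨integrable_norm_sq ((hrel m).sub (hnoise m)), ?_⟩
    rw [integral_norm_sub_smul_sq (hrel m) (h.memLp_noise t m r.H)
      (h.integral_inner_noise_of_past (h.sampleL2_relStep t m))]
    gcongr
    exact (h.meanLe_noise_sq t m r.H).integral_le
  refine ((MeanLe.sum Finset.univ hstep).mono (h.meanLe_spread (t + 1)).integrable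
    (r.spread_succ_le t) (le_of_eq ?_)).integral_le
  rw [integral_finsetSum _ fun m _ => integrable_norm_sq (hrel m), Finset.sum_add_distrib,
    Finset.sum_const, Finset.card_univ, Fintype.card_fin, nsmul_eq_mul]

lemma disagreement_succ_le (ha : r.η * r.L ≤ 1 / 32) (t : ℕ) :
    r.disagreement (t + 1) μ ≤ (1 + 5 * (r.η * r.L)) * r.disagreement t μ
      + (16 * (r.η * r.L) * ∑ m, r.resolventStep t m μ + 3 / 2 * (M * (r.η ^ 2 * σ ^ 2))) := by
  have hdis := (h.disagreement_succ_le_integral t).trans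
    (add_le_add_left (h.meanLe_sum_norm_relStep_sq t).integral_le _)
  have hN : 0 ≤ (M : ℝ) * (r.η ^ 2 * σ ^ 2) := by positivity
  have haN := mul_le_mul_of_nonneg_right ha hN
  rw [Finset.sum_add_distrib, ← Finset.mul_sum, Finset.sum_const, Finset.card_univ,
    Fintype.card_fin, nsmul_eq_mul] at hdis
  linarith

lemma sum_disagreement_le (haK : r.η * r.L * r.K ≤ 1 / 32) (T : ℕ) :
    ∑ t ∈ Finset.range T, r.disagreement t μ ≤ 2 * r.K * ∑ t ∈ Finset.range T,
      (16 * (r.η * r.L) * ∑ m, r.resolventStep t m μ + 3 / 2 * (M * (r.η ^ 2 * σ ^ 2))) := by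
  have ha := h.ηL_nonneg
  have ha32 : r.η * r.L ≤ 1 / 32 :=
    (le_mul_of_one_le_right ha (Nat.one_le_cast.2 h.K_pos)).trans haK
  refine sum_le_of_reset h.K_pos (by positivity : 0 ≤ 5 * (r.η * r.L)) (by linarith)
    (fun t => integral_nonneg fun ω => Finset.sum_nonneg fun m _ => sq_nonneg _) (fun t => ?_)
    (fun t ht => ?_) (h.disagreement_succ_le ha32) T
  · have hstep : 0 ≤ ∑ m, r.resolventStep t m μ :=
      Finset.sum_nonneg fun _ _ => resolventStep_nonneg
    positivity
  · change ∫ ω, r.spread t ω ∂μ = 0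
    rw [funext fun ω => r.spread_eq_zero_of_mod_eq_zero ω ht, integral_zero]

end IsRegular
end Run

namespace Run

section Iterates

variable {d M : ℕ} {Ω Ξ : Type*} (r : Run d M Ω Ξ) (t : ℕ) (ω : Ω)

lemma regret_mean_eq (w : Vec d) :
    M * (2 * r.η * inner ℝ (r.operatorMean t ω) (r.zMean t ω - w)) =
      M * ‖r.zMean t ω - w‖ ^ 2 - M * ‖r.zMean (t + 1) ω - w‖ ^ 2
        + r.η ^ 2 * (M * ‖r.operatorMean t ω‖ ^ 2)
        + M * noiseCost r.η (r.zMean t ω) (r.operatorMean t ω) (r.noiseMean t ω)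
        + 2 * r.η * (M * inner ℝ (r.noiseMean t ω) w) := by
  rw [two_mul_inner_sub_eq r.η _ _ _ (r.noiseMean t ω), ← zMean_succ, sub_self, inner_zero_right]
  ring

lemma mul_norm_operatorMean_sq_le :
    M * ‖r.operatorMean t ω‖ ^ 2 ≤ ∑ m, ‖r.V (r.x t m r.H ω)‖ ^ 2 := by
  simpa only [operatorMean, Fintype.card_fin] using
    card_mul_norm_avg_sq_le fun m => r.V (r.x t m r.H ω)

end Iterates

variable {d M : ℕ} {Ω Ξ : Type*} [MeasurableSpace Ω] [MeasurableSpace Ξ]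

namespace IsRegular

variable {r : Run d M Ω Ξ} {μ : Measure Ω} {P : Measure Ξ} {G σ : ℝ} (h : r.IsRegular μ P G σ)
include h

lemma regret_le_consensusError (w : Vec d) (t : ℕ) (ω : Ω) :
    r.regret t ω w ≤ M * ‖r.zMean t ω - w‖ ^ 2 - M * ‖r.zMean (t + 1) ω - w‖ ^ 2
      + (r.consensusError t ω + 2 * r.η * (M * inner ℝ (r.noiseMean t ω) w)) := by
  have hmean := mul_le_mul_of_nonneg_left (r.mul_norm_operatorMean_sq_le t ω) (sq_nonneg r.η)
  have hcross := Finset.sum_le_sum fun (m : Fin M) (_ : m ∈ Finset.univ) =>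
    two_mul_inner_sub_sub_le h.smooth h.η_pos.le h.ηL_pos (r.x t m r.H ω) (r.z t m ω) (r.zMean t ω)
  rw [regret_eq_progress_add, regret_mean_eq, consensusError, spread]
  simp only [Finset.sum_add_distrib, Finset.sum_sub_distrib, ← Finset.mul_sum] at hcross ⊢
  linarith

lemma meanLe_noiseCost_zMean (t : ℕ) :
    MeanLe μ
      (fun ω => noiseCost r.η (r.zMean t ω) (r.operatorMean t ω) (r.noiseMean t ω))
      (r.η ^ 2 * (σ ^ 2 / M)) :=
  meanLe_noiseCost (h.sampleL2_zMean t).memLp (h.sampleL2_operatorMean t).memLp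
    (h.memLp_noiseMean t) (h.integral_inner_noiseMean (h.sampleL2_zMean t))
    (h.integral_inner_noiseMean (h.sampleL2_operatorMean t)) (h.meanLe_norm_noiseMean_sq t) r.η

lemma meanLe_consensusError (t : ℕ) :
    MeanLe μ (r.consensusError t)
      (-(1 - 16 * (r.η * r.L)) * ∑ m, r.resolventStep t m μ
        + 3 * (r.η * r.L) * r.disagreement t μ
        + M * (9 * (r.η * r.L) * (r.η ^ 2 * σ ^ 2) + 2 * (r.η ^ 2 * G ^ 2) / 4 ^ r.H)
        + r.η ^ 2 * σ ^ 2) := by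
  have ha := h.ηL_nonneg
  have hM := h.M_pos_real
  refine (((((MeanLe.sum Finset.univ fun m _ => h.meanLe_progress_resolventStep t m).add
    ((h.meanLe_spread t).const_mul (by positivity : 0 ≤ 3 * (r.η * r.L)))).add
    ((MeanLe.sum Finset.univ fun m _ => h.meanLe_x_sub_z t m r.H).const_mul
      (by positivity : 0 ≤ 2 * (r.η * r.L)))).add
    ((h.meanLe_noiseCost_zMean t).const_mul hM.le))).trans_le (le_of_eq ?_)
  simp only [Finset.sum_add_distrib, ← Finset.mul_sum, Finset.sum_const, Finset.card_univ,
    Fintype.card_fin, nsmul_eq_mul]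
  field_simp
  ring

/-- When `η * L * K` is small, the resolvent steps pay for the disagreement they cause. -/
lemma meanLe_sum_consensusError (haK : r.η * r.L * r.K ≤ 1 / 32) (T : ℕ) :
    MeanLe μ (fun ω => ∑ t ∈ Finset.range T, r.consensusError t ω)
      (T * (2 * r.η * (M * (9 * (r.η * r.L * r.K * (r.η * σ ^ 2))
        + r.η * G ^ 2 / 4 ^ r.H + r.η * σ ^ 2 / (2 * M))))) := by
  refine (MeanLe.sum (Finset.range T) fun t _ => h.meanLe_consensusError t).trans_le ?_
  have hM := h.M_pos_real
  have ha := h.ηL_nonneg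
  have hK : (1 : ℝ) ≤ r.K := Nat.one_le_cast.2 h.K_pos
  have haa : r.η * r.L ≤ r.η * r.L * r.K := le_mul_of_one_le_right ha hK
  have hdis := mul_le_mul_of_nonneg_left (h.sum_disagreement_le haK T)
    (by positivity : 0 ≤ 3 * (r.η * r.L))
  simp only [Finset.sum_add_distrib, ← Finset.mul_sum, Finset.sum_const, Finset.card_range,
    nsmul_eq_mul] at hdis ⊢
  set A := ∑ t ∈ Finset.range T, ∑ m, r.resolventStep t m μ
  have hA : 0 ≤ A := Finset.sum_nonneg fun _ _ => Finset.sum_nonneg fun _ _ => resolventStep_nonneg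
  have hdisA := mul_le_mul_of_nonneg_right haK (by positivity : 0 ≤ 96 * (r.η * r.L) * A)
  have haA := mul_le_mul_of_nonneg_right (haa.trans haK) hA
  have hN : T * (M * (9 * (r.η * r.L) * (r.η ^ 2 * σ ^ 2))) ≤
      T * (M * (9 * (r.η * r.L * r.K) * (r.η ^ 2 * σ ^ 2))) := by gcongr
  calc _ ≤ T * (M * (9 * (r.η * r.L * r.K) * (r.η ^ 2 * σ ^ 2)))
        + T * (M * (9 * (r.η * r.L * r.K) * (r.η ^ 2 * σ ^ 2)))
        + T * (M * (2 * (r.η ^ 2 * G ^ 2) / 4 ^ r.H)) + T * (r.η ^ 2 * σ ^ 2) := by linarith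
    _ = _ := by
      field_simp
      ring

lemma integral_gap_output_le_of_mean {D : ℝ} {T : ℕ} (hD : 0 ≤ D) (hσ : 0 ≤ σ) (hT : 0 < T)
    (haK : r.η * r.L * r.K ≤ 1 / 32) :
    ∫ ω, gap r.V D (r.output ω T) ∂μ ≤ D ^ 2 / (2 * r.η * T)
      + (9 * (r.η * r.L * r.K * (r.η * σ ^ 2)) + r.η * G ^ 2 / 4 ^ r.H
        + r.η * σ ^ 2 / (2 * M)) + D * σ / √(M * T) := by
  refine h.integral_gap_output_le hD hσ hT (φ := fun w t ω => M * ‖r.zMean t ω - w‖ ^ 2)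
    (fun w ω => ?_) (fun w ω => by positivity) (h.meanLe_sum_consensusError haK T)
    h.regret_le_consensusError
  rw [zMean_zero, zero_sub, norm_neg]

end IsRegular
end Run

/-! ### The choice of the step size -/

section RateArithmetic

lemma sq_div_rpow_div_eq {D K R s α α' κ κ' ρ ρ' : ℝ} (hD : 0 < D) (hK : 0 < K) (hR : 0 < R)
    (hs : 0 < s) (hα : α + α' = 2) (hκ : κ + κ' = 1) (hρ : ρ + ρ' = 1) :
    D ^ 2 / (D ^ α / (K ^ κ * R ^ ρ * s) * (K * R)) = D ^ α' * s / (K ^ κ' * R ^ ρ') := by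
  rw [eq_sub_of_add_eq' hα, eq_sub_of_add_eq' hκ, eq_sub_of_add_eq' hρ, Real.rpow_sub hD,
    Real.rpow_sub hK, Real.rpow_sub hR, Real.rpow_two, Real.rpow_one, Real.rpow_one]
  field_simp

lemma sq_div_mul_le {D K R s α α' κ κ' ρ ρ' e : ℝ} (hD : 0 < D) (hK : 0 < K) (hR : 0 < R)
    (he : e = K ^ κ * R ^ ρ * s) (hs : 0 < s) (hα : α + α' = 2) (hκ : κ + κ' = 1)
    (hρ : ρ + ρ' = 1) : D ^ 2 / (D ^ α / e * (K * R)) ≤ D ^ α' * s / (K ^ κ' * R ^ ρ') :=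
  he ▸ (sq_div_rpow_div_eq hD hK hR hs hα hκ hρ).le

lemma div_min_mul_le_add {A C x y a b : ℝ} (ha : 0 ≤ a) (hb : 0 ≤ b) (hx : A / (x * C) ≤ a)
    (hy : A / (y * C) ≤ b) : A / (min x y * C) ≤ a + b := by
  rcases min_choice x y with h | h <;> rw [h] <;> linarith

variable {L D σ Lam : ℝ} {M K R : ℕ}

/-- The sum of the rate terms in the gap bound of LIPPAX, without the numerical constant and
without the bias of the inner loops. -/
def gapRate (d : ℕ) (L D σ Lam : ℝ) (M K R : ℕ) : ℝ :=
  (D ^ 2 * L / ((K : ℝ) * R)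
      + D ^ (4 / 3 : ℝ) * L ^ (1 / 3 : ℝ) * σ ^ (2 / 3 : ℝ)
          / ((K : ℝ) ^ (1 / 3 : ℝ) * (R : ℝ) ^ (2 / 3 : ℝ))
      + D * σ / Real.sqrt ((M : ℝ) * K * R))
    + (D ^ (8 / 5 : ℝ) * σ ^ (2 / 5 : ℝ) * L ^ (2 / 5 : ℝ)
          / ((K : ℝ) ^ (2 / 5 : ℝ) * (R : ℝ) ^ (4 / 5 : ℝ))
      + D ^ (3 / 2 : ℝ) * σ ^ (1 / 2 : ℝ) * L ^ (1 / 2 : ℝ)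
          / ((K : ℝ) ^ (3 / 4 : ℝ) * (R : ℝ) ^ (3 / 4 : ℝ))
      + D ^ (5 / 3 : ℝ) * (d : ℝ) ^ (1 / 6 : ℝ) * Lam ^ (1 / 3 : ℝ) * σ ^ (2 / 3 : ℝ)
          / ((R : ℝ) ^ (5 / 6 : ℝ) * (K : ℝ) ^ (5 / 6 : ℝ)))

lemma le_gapRate {x : ℝ} (hL : 0 ≤ L) (hD : 0 ≤ D) (hσ : 0 ≤ σ) (hLam : 0 ≤ Lam) (d : ℕ)
    (hx : x ≤ D ^ 2 * L / ((K : ℝ) * R) + D * σ / √((M : ℝ) * K * R)) :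
    x ≤ gapRate d L D σ Lam M K R := by
  have h₁ : 0 ≤ D ^ (4 / 3 : ℝ) * L ^ (1 / 3 : ℝ) * σ ^ (2 / 3 : ℝ)
      / ((K : ℝ) ^ (1 / 3 : ℝ) * (R : ℝ) ^ (2 / 3 : ℝ)) := by positivity
  refine hx.trans ?_
  rw [gapRate, add_right_comm (_ * L / _)]
  refine le_add_of_le_of_nonneg (le_add_of_nonneg_right h₁) ?_
  positivity

lemma gapRate_nonneg (hL : 0 ≤ L) (hD : 0 ≤ D) (hσ : 0 ≤ σ) (hLam : 0 ≤ Lam) (d : ℕ) :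
    0 ≤ gapRate d L D σ Lam M K R :=
  le_gapRate hL hD hσ hLam d (by positivity)

lemma stepSize_pos (hL : 0 < L) (hLam : 0 < Lam) (hD : 0 < D) (hσ : 0 ≤ σ) (hM : 0 < M)
    (hK : 0 < K) (hR : 0 < R) : 0 < stepSize L D σ Lam M K R := by
  rw [stepSize]
  split_ifs with h
  · positivity
  · have : 0 < σ := lt_of_le_of_ne' hσ h
    positivity

lemma stepSize_mul_le_one (hL : 0 < L) : stepSize L D σ Lam M K R * L ≤ 1 := by
  rw [← le_div_iff₀ hL, stepSize]
  split_ifs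
  · exact le_rfl
  · exact min_le_left _ _

lemma stepSize_pow_three_mul_le (hL : 0 < L) (hLam : 0 < Lam) (hD : 0 < D) (hσ : 0 ≤ σ)
    (hM : 0 < M) (hK : 0 < K) (hR : 0 < R) :
    stepSize L D σ Lam M K R ^ 3 * ((K : ℝ) ^ 2 * R * σ ^ 2 * L) ≤ D ^ 2 := by
  have hpos := stepSize_pos hL hLam hD hσ hM hK hR
  rcases hσ.eq_or_lt with rfl | hσ'
  · simpa using sq_nonneg D
  have hle : stepSize L D σ Lam M K R ≤ D ^ (2 / 3 : ℝ) /
      ((K : ℝ) ^ (2 / 3 : ℝ) * (R : ℝ) ^ (1 / 3 : ℝ) * σ ^ (2 / 3 : ℝ) * L ^ (1 / 3 : ℝ)) := by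
    simp only [stepSize, if_neg hσ'.ne', min_le_iff, le_refl, true_or, or_true]
  rw [le_div_iff₀ (by positivity)] at hle
  have hcube := pow_le_pow_left₀ (by positivity) hle 3
  have htwo : ∀ x : ℝ, 0 ≤ x → (x ^ (2 / 3 : ℝ)) ^ 3 = x ^ 2 := fun x hx => by
    rw [← Real.rpow_mul_natCast hx]; norm_num
  have hone : ∀ x : ℝ, 0 ≤ x → (x ^ (1 / 3 : ℝ)) ^ 3 = x := fun x hx => by
    rw [← Real.rpow_mul_natCast hx]; norm_num
  simpa only [mul_pow, htwo D hD.le, htwo σ hσ, htwo K (Nat.cast_nonneg K),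
    hone R (Nat.cast_nonneg R), hone L hL.le] using hcube

lemma stepSize_sq_mul_le (hL : 0 < L) (hLam : 0 < Lam) (hD : 0 < D) (hσ : 0 ≤ σ) (hM : 0 < M)
    (hK : 0 < K) (hR : 0 < R) :
    stepSize L D σ Lam M K R ^ 2 * ((K : ℝ) * R * σ ^ 2) ≤ D ^ 2 * M := by
  have hpos := stepSize_pos hL hLam hD hσ hM hK hR
  rcases hσ.eq_or_lt with rfl | hσ'
  · simpa using mul_nonneg (sq_nonneg D) (Nat.cast_nonneg M)
  have hle : stepSize L D σ Lam M K R ≤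
      D * √M / ((K : ℝ) ^ (1 / 2 : ℝ) * (R : ℝ) ^ (1 / 2 : ℝ) * σ) := by
    simp only [stepSize, if_neg hσ'.ne', min_le_iff, le_refl, or_true]
  rw [le_div_iff₀ (by positivity), ← Real.sqrt_eq_rpow, ← Real.sqrt_eq_rpow] at hle
  simpa only [mul_pow, Real.sq_sqrt (Nat.cast_nonneg _)] using
    pow_le_pow_left₀ (by positivity) hle 2

lemma sq_div_sqrt_div_eq (hD : 0 < D) (hσ : 0 < σ) (hM : 0 < M) (hK : 0 < K) (hR : 0 < R) :
    D ^ 2 / (D * √M / ((K : ℝ) ^ (1 / 2 : ℝ) * (R : ℝ) ^ (1 / 2 : ℝ) * σ) * (K * R)) =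
      D * σ / √((M : ℝ) * K * R) := by
  have h := sq_div_rpow_div_eq (s := σ / √M) hD (Nat.cast_pos.2 hK) (Nat.cast_pos.2 hR)
    (by positivity) (one_add_one_eq_two) (add_halves (1 : ℝ)) (add_halves (1 : ℝ))
  rw [Real.rpow_one, ← Real.sqrt_eq_rpow, ← Real.sqrt_eq_rpow] at h
  rw [← Real.sqrt_eq_rpow, ← Real.sqrt_eq_rpow, mul_assoc (M : ℝ),
    Real.sqrt_mul (Nat.cast_nonneg M), Real.sqrt_mul (Nat.cast_nonneg K)]
  convert h using 1
  · field_simp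
  · field_simp

lemma sq_div_lambda_term_le (hD : 0 ≤ D) (hσ : 0 ≤ σ) (hLam : 0 ≤ Lam) {d : ℕ} (hd : 0 < d) :
    D ^ (5 / 3 : ℝ) * (Lam ^ (1 / 3 : ℝ) * σ ^ (2 / 3 : ℝ))
        / ((K : ℝ) ^ (5 / 6 : ℝ) * (R : ℝ) ^ (5 / 6 : ℝ)) ≤
      D ^ (5 / 3 : ℝ) * (d : ℝ) ^ (1 / 6 : ℝ) * Lam ^ (1 / 3 : ℝ) * σ ^ (2 / 3 : ℝ)
        / ((R : ℝ) ^ (5 / 6 : ℝ) * (K : ℝ) ^ (5 / 6 : ℝ)) := by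
  have hd1 : 1 ≤ (d : ℝ) ^ (1 / 6 : ℝ) := Real.one_le_rpow (Nat.one_le_cast.2 hd) (by norm_num)
  rw [mul_comm ((K : ℝ) ^ _), mul_assoc (_ * _) (Lam ^ _)]
  gcongr
  exact le_mul_of_one_le_right (by positivity) hd1

/-- Each candidate in the minimum defining `stepSize` turns `D ^ 2 / (η * K * R)` into one of the
terms of `gapRate`. -/
lemma sq_div_stepSize_mul_le (hL : 0 < L) (hLam : 0 < Lam) (hD : 0 < D) (hσ : 0 ≤ σ) (hM : 0 < M)
    (hK : 0 < K) (hR : 0 < R) {d : ℕ} (hd : 0 < d) :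
    D ^ 2 / (stepSize L D σ Lam M K R * ((K : ℝ) * R)) ≤ gapRate d L D σ Lam M K R := by
  have hsmooth : D ^ 2 / (1 / L * ((K : ℝ) * R)) ≤ D ^ 2 * L / ((K : ℝ) * R) := by
    rw [one_div_mul_eq_div, div_div_eq_mul_div]
  rcases hσ.eq_or_lt with rfl | hσ'
  · rw [stepSize, if_pos rfl]
    exact le_gapRate hL.le hD.le le_rfl hLam.le d
      (hsmooth.trans (le_add_of_nonneg_right (by positivity)))
  have hK' : (0 : ℝ) < K := Nat.cast_pos.2 hK
  have hR' : (0 : ℝ) < R := Nat.cast_pos.2 hR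
  rw [stepSize, if_neg hσ'.ne']
  refine (div_min_mul_le_add (by positivity) (by positivity) hsmooth <|
    div_min_mul_le_add (by positivity) (by positivity)
      (sq_div_mul_le (α' := 8 / 5) (κ' := 2 / 5) (ρ' := 4 / 5) hD hK' hR'
        (mul_assoc (_ * _) _ _) (by positivity) (by norm_num) (by norm_num) (by norm_num)) <|
    div_min_mul_le_add (by positivity) (by positivity)
      (sq_div_mul_le (α' := 4 / 3) (κ' := 1 / 3) (ρ' := 2 / 3) hD hK' hR'
        (mul_assoc (_ * _) _ _) (by positivity) (by norm_num) (by norm_num) (by norm_num)) <|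
    div_min_mul_le_add (by positivity) (by positivity)
      (sq_div_mul_le (α' := 3 / 2) (κ' := 3 / 4) (ρ' := 3 / 4) hD hK' hR'
        (mul_assoc (_ * _) _ _) (by positivity) (by norm_num) (by norm_num) (by norm_num)) <|
    div_min_mul_le_add (by positivity) (by positivity)
      ((sq_div_mul_le (α' := 5 / 3) (κ' := 5 / 6) (ρ' := 5 / 6) hD hK' hR'
        (by ring) (by positivity) (by norm_num) (by norm_num) (by norm_num)).trans
        (sq_div_lambda_term_le hD.le hσ hLam.le hd))
      (sq_div_sqrt_div_eq hD hσ' hM hK hR).le).trans (le_of_eq ?_)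
  rw [gapRate]
  ring

end RateArithmetic

namespace Run.IsRegular

variable {d M : ℕ} {Ω Ξ : Type*} [MeasurableSpace Ω] [MeasurableSpace Ξ] {r : Run d M Ω Ξ}
  {μ : Measure Ω} {P : Measure Ξ} {G σ D : ℝ} {R : ℕ} (h : r.IsRegular μ P G σ)
include h

lemma η_mul_sq_div_le (hD : 0 ≤ D) (hσ : 0 ≤ σ) (hR : 0 < R)
    (hsq : r.η ^ 2 * (r.K * R * σ ^ 2) ≤ D ^ 2 * M) :
    r.η * σ ^ 2 / (2 * M) ≤ D * σ / √(M * r.K * R) := by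
  have hM := h.M_pos_real
  have hK : (0 : ℝ) < r.K := Nat.cast_pos.2 h.K_pos
  have hroot : r.η * σ * √(M * r.K * R) ≤ D * M := by
    refine le_of_sq_le_sq ?_ (by positivity)
    rw [mul_pow, Real.sq_sqrt (by positivity)]
    linarith [mul_le_mul_of_nonneg_right hsq hM.le]
  rw [div_le_div_iff₀ (by positivity) (by positivity)]
  have := mul_le_mul_of_nonneg_right hroot hσ
  have : 0 ≤ D * M * σ := by positivity
  linarith

/-- If `η * L * K` is large, then `hcube` makes the local noise `η * σ ^ 2` negligible. -/
lemma integral_gap_output_le_of_cube_of_sq (hD : 0 ≤ D) (hσ : 0 ≤ σ) (hR : 0 < R)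
    (hcube : r.η ^ 3 * (r.K ^ 2 * R * σ ^ 2 * r.L) ≤ D ^ 2)
    (hsq : r.η ^ 2 * (r.K * R * σ ^ 2) ≤ D ^ 2 * M) :
    ∫ ω, gap r.V D (r.output ω (r.K * R)) ∂μ ≤ 97 * (D ^ 2 / (r.η * (r.K * R)))
      + 2 * (D * σ / √(M * r.K * R)) + 180 * (r.η * G ^ 2) / 4 ^ r.H := by
  have hη := h.η_pos
  have hK : (0 : ℝ) < r.K := Nat.cast_pos.2 h.K_pos
  have hT : 0 < r.K * R := Nat.mul_pos h.K_pos hR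
  have hlocal : r.η * r.L * r.K * (r.η * σ ^ 2) ≤ D ^ 2 / (r.η * (r.K * R)) := by
    rw [le_div_iff₀ (by positivity)]
    linarith
  have hhalf : D ^ 2 / (2 * r.η * (r.K * R)) = 1 / 2 * (D ^ 2 / (r.η * (r.K * R))) := by
    field_simp
  have hlead : 0 ≤ D ^ 2 / (r.η * (r.K * R)) := by positivity
  have hrate : 0 ≤ D * σ / √(M * r.K * R) := by positivity
  have hbias : 0 ≤ r.η * G ^ 2 / 4 ^ r.H := by positivity
  rw [mul_div_assoc 180]
  rcases le_total (r.η * r.L * r.K) (1 / 32) with hsmall | hlarge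
  · have hgap := h.integral_gap_output_le_of_mean hD hσ hT hsmall
    rw [Nat.cast_mul, hhalf, ← mul_assoc (M : ℝ)] at hgap
    linarith [h.η_mul_sq_div_le hD hσ hR hsq]
  · have hgap := h.integral_gap_output_le_of_local hD hσ hT
    rw [Nat.cast_mul, hhalf, ← mul_assoc (M : ℝ), mul_div_assoc 180] at hgap
    linarith [mul_le_mul_of_nonneg_right hlarge (by positivity : 0 ≤ r.η * σ ^ 2)]

lemma integral_gap_output_le_gapRate {Lam : ℝ} (hLam : 0 < Lam) (hD : 0 < D) (hσ : 0 ≤ σ)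
    (hR : 0 < R) (hη : r.η = stepSize r.L D σ Lam M r.K R) :
    ∫ ω, gap r.V D (r.output ω (r.K * R)) ∂μ ≤
      240 * gapRate d r.L D σ Lam M r.K R + 180 * (r.η * G ^ 2) / 4 ^ r.H := by
  have hηpos := h.η_pos
  have hrate := gapRate_nonneg (M := M) (K := r.K) (R := R) h.L_pos.le hD.le hσ hLam.le d
  rcases d.eq_zero_or_pos with rfl | hd
  · refine (integral_nonpos fun ω => gap_le hD.le fun w _ => ?_).trans (by positivity)
    rw [Subsingleton.elim (r.V w) 0, inner_zero_left, Pi.zero_apply]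
  · have hcube := stepSize_pow_three_mul_le h.L_pos hLam hD hσ h.M_pos h.K_pos hR
    have hsq := stepSize_sq_mul_le h.L_pos hLam hD hσ h.M_pos h.K_pos hR
    have hlead := sq_div_stepSize_mul_le h.L_pos hLam hD hσ h.M_pos h.K_pos hR hd
    have hnoise := le_gapRate h.L_pos.le hD.le hσ hLam.le (M := M) (K := r.K) (R := R) d
      (le_add_of_nonneg_left (by have := h.L_pos; positivity))
    rw [← hη] at hcube hsq hlead
    linarith [h.integral_gap_output_le_of_cube_of_sq hD.le hσ hR hcube hsq]

end Run.IsRegular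

lemma bias_le {η : ℝ} (hη : η ≤ 1) {K : ℕ} (hK : 1 ≤ K) (G Lam : ℝ) (H : ℕ) :
    180 * (η * G ^ 2) / 4 ^ H ≤
      (10 * (H : ℝ) ^ 2 * Lam ^ 2 * G ^ 4 + 60 * G ^ 2 + 120 * G ^ 2 * (K : ℝ) ^ 2) / 4 ^ H := by
  have hK2 : G ^ 2 ≤ G ^ 2 * (K : ℝ) ^ 2 :=
    le_mul_of_one_le_right (sq_nonneg G) (one_le_pow₀ (Nat.one_le_cast.2 hK))
  have hη2 : η * G ^ 2 ≤ G ^ 2 := mul_le_of_le_one_left (sq_nonneg G) hη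
  have hLam : 0 ≤ 10 * (H : ℝ) ^ 2 * Lam ^ 2 * G ^ 4 := by positivity
  gcongr
  linarith

end FedVI

end

theorem mainTheorem6_general {d : ℕ} {Ω Ξ : Type*} [MeasurableSpace Ω] [MeasurableSpace Ξ]
    (μ : MeasureTheory.Measure Ω) (P : MeasureTheory.Measure Ξ)
    (V : FedVI.Vec d → FedVI.Vec d) (Vt : FedVI.Vec d → Ξ → FedVI.Vec d)
    (L G σ Lam D : ℝ) (M K R H : ℕ) (ξ : ℕ → Fin M → ℕ → Ω → Ξ) (η γ : ℝ)
    (hL : 0 < L) (hLam : 0 < Lam) (hD : 0 < D) (hσ : 0 ≤ σ)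
    (hM : 1 ≤ M) (hK : 1 ≤ K) (hR : 1 ≤ R)
    (hmono : FedVI.MonotoneOp V) (hsmooth : FedVI.SmoothOp L V) (hG : ∀ x, ‖V x‖ ≤ G)
    (horacle : FedVI.IsOracle V Vt P σ) (hξ : FedVI.IsIIDSample ξ P μ)
    (hη : η = FedVI.stepSize L D σ Lam M K R) (hγ : γ = FedVI.innerStepSize L η) :
    MeasureTheory.Integrable (fun ω => FedVI.gap V D
      (FedVI.lippaxOutput Vt η γ H K (K * R) (fun t m ℓ => ξ t m ℓ ω))) μ ∧
    ∫ ω, FedVI.gap V D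
      (FedVI.lippaxOutput Vt η γ H K (K * R) (fun t m ℓ => ξ t m ℓ ω)) ∂μ
    ≤ 240 * FedVI.gapRate d L D σ Lam M K R + 180 * (η * G ^ 2) / 4 ^ H := by
  subst hγ
  have hμ := hξ.isProbabilityMeasure
  have hreg : FedVI.Run.IsRegular ⟨V, Vt, ξ, L, η, H, K⟩ μ P G σ :=
    { mono := hmono, smooth := hsmooth, bound := hG, oracle := horacle, iid := hξ, L_pos := hL
      η_pos := hη ▸ FedVI.stepSize_pos hL hLam hD hσ hM hK hR
      ηL_le := hη ▸ FedVI.stepSize_mul_le_one hL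
      M_pos := hM, K_pos := hK }
  exact ⟨FedVI.integrable_gap hG hD.le (hreg.integrable_output (K * R)),
    hreg.integral_gap_output_le_gapRate hLam hD hσ hR hη⟩

theorem mainTheorem6 {d : ℕ} {Ω Ξ : Type*} [MeasurableSpace Ω] [MeasurableSpace Ξ]
    (μ : MeasureTheory.Measure Ω) [MeasureTheory.IsProbabilityMeasure μ]
    (P : MeasureTheory.Measure Ξ) [MeasureTheory.IsProbabilityMeasure P]
    (V : FedVI.Vec d → FedVI.Vec d) (Vt : FedVI.Vec d → Ξ → FedVI.Vec d)
    (L G σ Lam D : ℝ) (M K R H : ℕ) (ξ : ℕ → Fin M → ℕ → Ω → Ξ) (η γ : ℝ)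
    (hL : 0 < L) (hLam : 0 < Lam) (hD : 0 < D) (hσ : 0 ≤ σ)
    (hM : 1 ≤ M) (hK : 1 ≤ K) (hR : 1 ≤ R)
    (hmono : FedVI.MonotoneOp V) (hsmooth : FedVI.SmoothOp L V) (hG : ∀ x, ‖V x‖ ≤ G)
    (hsecond : FedVI.SecondOrderBounded Lam V)
    (horacle : FedVI.IsOracle V Vt P σ) (hξ : FedVI.IsIIDSample ξ P μ)
    (hη : η = FedVI.stepSize L D σ Lam M K R) (hη1 : η ≤ 1)
    (hγ : γ = FedVI.innerStepSize L η) :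
    MeasureTheory.Integrable (fun ω => FedVI.gap V D
      (FedVI.lippaxOutput Vt η γ H K (K * R) (fun t m ℓ => ξ t m ℓ ω))) μ ∧
    ∫ ω, FedVI.gap V D
      (FedVI.lippaxOutput Vt η γ H K (K * R) (fun t m ℓ => ξ t m ℓ ω)) ∂μ
    ≤ 240 * (D ^ 2 * L / ((K : ℝ) * R)
          + D ^ (4 / 3 : ℝ) * L ^ (1 / 3 : ℝ) * σ ^ (2 / 3 : ℝ)
              / ((K : ℝ) ^ (1 / 3 : ℝ) * (R : ℝ) ^ (2 / 3 : ℝ))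
          + D * σ / Real.sqrt ((M : ℝ) * K * R))
      + 240 * (D ^ (8 / 5 : ℝ) * σ ^ (2 / 5 : ℝ) * L ^ (2 / 5 : ℝ)
              / ((K : ℝ) ^ (2 / 5 : ℝ) * (R : ℝ) ^ (4 / 5 : ℝ))
          + D ^ (3 / 2 : ℝ) * σ ^ (1 / 2 : ℝ) * L ^ (1 / 2 : ℝ)
              / ((K : ℝ) ^ (3 / 4 : ℝ) * (R : ℝ) ^ (3 / 4 : ℝ))
          + D ^ (5 / 3 : ℝ) * (d : ℝ) ^ (1 / 6 : ℝ) * Lam ^ (1 / 3 : ℝ) * σ ^ (2 / 3 : ℝ)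
              / ((R : ℝ) ^ (5 / 6 : ℝ) * (K : ℝ) ^ (5 / 6 : ℝ)))
      + (10 * (H : ℝ) ^ 2 * Lam ^ 2 * G ^ 4 + 60 * G ^ 2 + 120 * G ^ 2 * (K : ℝ) ^ 2)
          / 4 ^ H := by
  obtain ⟨hint, hle⟩ := mainTheorem6_general μ P V Vt L G σ Lam D M K R H ξ η γ hL hLam hD hσ hM hK
    hR hmono hsmooth hG horacle hξ hη hγ
  exact ⟨hint, hle.trans (add_le_add (mul_add _ _ _).le (FedVI.bias_le hη1 hK G Lam H))⟩
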